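/- Let $S$ be a finite set and let $q(x,y)\ge 0$ ($x\ne y$ in $S$) be the jump rates of a continuous-time Markov chain on $S$; put $q_{\max}=\max_x\sum_{y\ne x}q(x,y)$. The noisy voter model with voting mechanism $(S,q)$ is the continuous-time Markov chain on $\{0,1\}^S$ that, in the configuration $\eta$, flips the value at each site $x$ at rate $\frac12+\sum_{y\ne x,\ \eta(y)\ne\eta(x)}q(x,y)$. Write $\mu^\eta_t$ for its law at time $t$ when started from $\eta$, $\mu_\infty$ for its stationary distribution, $\|m_1-m_2\|_{TV}=\frac12\sum_s|m_1(s)-m_2(s)|$, $d(t)=\max_\eta\|\mu^\eta_t-\mu_\infty\|_{TV}$, and $t_{mix}(\varepsilon)=\inf\{t\ge 0: d(t)\le\varepsilon\}$. Let $(S^n,q^n)_{n}$ be a sequence of such chains with $|S^n|\to\infty$; use the superscript or subscript $n$ for the objects belonging to the $n$-th noisy voter model. (a) Each $\mu^n_\infty$ exists and is unique, and $$\lim_{\alpha\to\infty}\limsup_{n\to\infty}\ d_n\bigl(\tfrac12\log|S^n|+\alpha\bigr)=0 ;$$ moreover, for all $\varepsilon>0$ and $\delta>0$, $t^n_{mix}(\varepsilon)\le\frac12\log|S^n|\,(1+\delta)$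 for all large $n$. (b) Assume in addition that $\sup_n q^n_{\max}<\infty$ and that there is a constant $C$ such that, for each $n$, the chain $(S^n,q^n)$ has a stationary distribution with strictly positive point masses whose ratio of the largest to the smallest point mass is at most $C$. Then for every $\varepsilon\in(0,1)$, $$t^n_{mix}(\varepsilon)=\tfrac12\log|S^n|\,(1+o(1))\quad\text{as } n\to\infty,$$ and, with $\mathbf 1$ the configuration of all ones, $$\lim_{\alpha\to\infty}\liminf_{n\to\infty}\bigl\|\mu^{n,\mathbf 1}_{\frac12\log|S^n|-\alpha}-\mu^n_\infty\bigr\|_{TV}=1 .$$ Furthermore the sequence of noisy voter models exhibits cutoff with a window of order $1$: $t^n_{mix}(\varepsilon)/t^n_{mix}(1-\varepsilon)\to1$ for every $\varepsilon\in(0,1)$, and, with $t^n_{mix}=t^n_{mix}(1/4)$, one has $1=o(t^n_{mix})$, $$\lim_{\alpha\to\infty}\liminf_{n\to\infty}d_n(t^n_{mix}-\alpha)=1\quad\text{and}\quad\lim_{\alpha\to\infty}\limsup_{n\to\infty}d_n(t^n_{mix}+\alpha)=0 .$$ -/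

import Mathlib

open Filter Topology

noncomputable section

namespace NoisyVoter

/-! ### Continuous-time Markov chains on a finite set

A chain on `Ω` is given by its jump rates `r : Ω → Ω → ℝ`; only the off-diagonal values matter. -/

section Chain

variable {Ω : Type*} [Fintype Ω] [DecidableEq Ω]

/-- Total rate `∑_{y ≠ x} r(x,y)` of leaving the state `x`. -/
def exitRate (r : Ω → Ω → ℝ) (x : Ω) : ℝ :=
  ∑ y ∈ Finset.univ.erase x, r x y

/-- `max_x ∑_{y ≠ x} r(x,y)`, the maximal rate of leaving a state. -/
def maxExitRate (r : Ω → Ω → ℝ) : ℝ :=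
  ⨆ x, exitRate r x

/-- The generator (Q-matrix) of the chain with jump rates `r`. -/
def generator (r : Ω → Ω → ℝ) : Matrix Ω Ω ℝ :=
  Matrix.of fun x y => if x = y then -exitRate r x else r x y

/-- The transition matrix `P^t = exp (t Q)` (used for `t ≥ 0`). -/
def transition (r : Ω → Ω → ℝ) (t : ℝ) : Matrix Ω Ω ℝ :=
  NormedSpace.exp (t • generator r)

/-- The law at time `t` of the chain started from `x`, as a mass function on `Ω`. -/
def law (r : Ω → Ω → ℝ) (x : Ω) (t : ℝ) : Ω → ℝ :=
  fun y => transition r t x y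

/-- `π` is a probability mass function on `Ω` with `π P^t = π` for all `t ≥ 0`. -/
structure IsStationary (r : Ω → Ω → ℝ) (π : Ω → ℝ) : Prop where
  nonneg : ∀ x, 0 ≤ π x
  sum_eq_one : ∑ x, π x = 1
  invariant : ∀ t : ℝ, 0 ≤ t → Matrix.vecMul π (transition r t) = π

/-- Total variation distance of two mass functions on a finite set. -/
def tvDist (m₁ m₂ : Ω → ℝ) : ℝ :=
  (1 / 2) * ∑ s, |m₁ s - m₂ s|

/-- Worst-case distance `d(t) = max_x ‖P^t(x,·) - π‖_TV`. -/
def worstDist (r : Ω → Ω → ℝ) (π : Ω → ℝ) (t : ℝ) : ℝ :=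
  ⨆ x, tvDist (law r x t) π

end Chain

/-! ### Mixing times and cutoff, for worst-case distance functions `d : ℝ → ℝ` -/

/-- `t_mix(ε) = inf {t ≥ 0 : d(t) ≤ ε}`. -/
def mixingTime (d : ℝ → ℝ) (ε : ℝ) : ℝ :=
  sInf {t : ℝ | 0 ≤ t ∧ d t ≤ ε}

/-- Cutoff for a sequence of chains with worst-case distances `d n`. -/
def HasCutoff (d : ℕ → ℝ → ℝ) : Prop :=
  ∀ ε : ℝ, 0 < ε → ε < 1 →
    Tendsto (fun n => mixingTime (d n) ε / mixingTime (d n) (1 - ε)) atTop (𝓝 1)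

/-- Cutoff with a window of size `w n`; the mixing time is `t_mix = t_mix(1/4)`. -/
def HasCutoffWithWindow (d : ℕ → ℝ → ℝ) (w : ℕ → ℝ) : Prop :=
  (w =o[atTop] fun n => mixingTime (d n) (1 / 4)) ∧
  Tendsto (fun α : ℝ => liminf (fun n => d n (mixingTime (d n) (1 / 4) - α * w n)) atTop)
    atTop (𝓝 1) ∧
  Tendsto (fun α : ℝ => limsup (fun n => d n (mixingTime (d n) (1 / 4) + α * w n)) atTop)
    atTop (𝓝 0)

/-! ### The noisy voter model -/

section Model

variable {S : Type*} [Fintype S] [DecidableEq S]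

/-- The configuration `η` with the value at the site `x` flipped
(`true` stands for `1`, `false` for `0`). -/
def flipAt (η : S → Bool) (x : S) : S → Bool :=
  Function.update η x (!η x)

/-- Rate at which the site `x` flips in the configuration `η`: the site adopts the value of
`y` at rate `q(x,y)`, and rerandomizes at rate `1`, hence changes with rate `1/2` that way. -/
def flipRate (q : S → S → ℝ) (η : S → Bool) (x : S) : ℝ :=
  1 / 2 + ∑ y ∈ Finset.univ.erase x, if η y ≠ η x then q x y else 0

/-- Jump rates on `{0,1}^S` of the noisy voter model with voting mechanism `(S,q)`. -/
def rate (q : S → S → ℝ) (η ξ : S → Bool) : ℝ :=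
  ∑ x, if ξ = flipAt η x then flipRate q η x else 0

/-- The configuration of all ones. -/
def allOnes (S : Type*) : S → Bool := fun _ => true

end Model

end NoisyVoter

end

/-! Everything follows from two bounds at time `t`, uniform in the voting mechanism up to a
constant: `d(t) ≤ √|S| e^{-t}`, and, in the setting of (b), distance at least `1 - K e^{2t} / |S|`
from the all-ones start. With `L = ½ log |S|` they read `e^{L - t}` and `1 - K e^{2(t - L)}`, so the
transition sits at `L` with a window of order 1.

Upper bound (`tvDist_law_law_le`). Over a short time `h` the chain is noise of strength `1 - h` at
every site followed by a mixture of copying steps. A product of noise and copying steps broadcasts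
root bits along a forest whose leaves are the final sites. The information a family of leaves
carries about its root bit is measured by `discrimination`, a form of triangular discrimination.
Noise multiplies it by the square of the noise parameter (`discrimination_mix`), and merging two
trees at most adds it (`discrimination_mul_le`). Hence it never exceeds `θ ^ 2` per leaf, whatever
the genealogy, and `|S| θ ^ 2` in total. Cauchy–Schwarz gives total variation at most `√|S| θ`,
which survives mixtures and the limit `θ = (1 - t/k)^k → e^{-t}` (`tendsto_pow_exp_of_hasDerivAt`).

Lower bound (`one_sub_le_tvDist_law`). Weighted by a stationary law of the voting chain, the
magnetization is an eigenfunction with eigenvalue `-1`. From all ones its mean is `e^{-t}`, while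
its variance is `O(1/|S|)` both at time `t` and in equilibrium, because each weight is `O(1/|S|)`
and the flip rates are bounded. Chebyshev's inequality separates the two laws. -/

/-! ### Independent coordinates and the chi-square discrimination of two densities -/

section Discrimination

open scoped BigOperators

variable {S : Type*} [Fintype S] [DecidableEq S]

/-- Functions of disjoint sets of coordinates are independent under the uniform measure. -/
theorem expect_mul_of_dependsOn {f g : (S → Bool) → ℝ} {s t : Set S}
    (hf : DependsOn f s) (hg : DependsOn g t) (hst : Disjoint s t) :
    𝔼 ω, f ω * g ω = (𝔼 ω, f ω) * 𝔼 ω, g ω := by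
  classical
  -- Two independent samples exchange their coordinates outside `s`. This preserves the uniform
  -- measure on pairs and puts the arguments of `f` and `g` into one sample.
  let swap : (S → Bool) × (S → Bool) → (S → Bool) × (S → Bool) := fun p =>
    (fun i => if i ∈ s then p.1 i else p.2 i, fun i => if i ∈ s then p.2 i else p.1 i)
  have hswap : Function.Involutive swap := by
    intro p
    ext i <;> by_cases h : i ∈ s <;> simp [swap, h]
  have h1 : ∀ p : (S → Bool) × (S → Bool), f p.1 * g p.2 = f (swap p).1 * g (swap p).1 := by
    intro p
    congr 1
    · exact hf fun i hi => by simp [swap, hi]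
    · exact hg fun i hi => by simp [swap, hst.notMem_of_mem_right hi]
  have h2 : ∑ p : (S → Bool) × (S → Bool), f p.1 * g p.2
      = ∑ p : (S → Bool) × (S → Bool), f p.1 * g p.1 := by
    rw [Finset.sum_congr rfl fun p _ => h1 p]
    exact Equiv.sum_comp hswap.toPerm (fun p => f p.1 * g p.1)
  rw [Fintype.sum_prod_type, Fintype.sum_prod_type] at h2
  simp only [← Finset.mul_sum, ← Finset.sum_mul, Finset.sum_const, Finset.card_univ,
    nsmul_eq_mul] at h2
  have hc : (Fintype.card (S → Bool) : ℝ) ≠ 0 := by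
    exact_mod_cast Fintype.card_ne_zero
  simp only [Fintype.expect_eq_sum_div_card]
  simp only [mul_left_comm (f _), ← Finset.mul_sum] at h2
  rw [div_mul_div_comm, h2, mul_div_mul_left _ _ hc]

/-- Half the triangular discrimination of two densities with respect to the uniform measure:
the chi-square information which an observation carries about a fair bit. -/
noncomputable def discrimination (f g : (S → Bool) → ℝ) : ℝ :=
  𝔼 ω, (f ω - g ω) ^ 2 / (2 * (f ω + g ω))

theorem discrimination_self (f : (S → Bool) → ℝ) : discrimination f f = 0 := by
  simp [discrimination]

theorem discrimination_comm (f g : (S → Bool) → ℝ) :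
    discrimination f g = discrimination g f := by
  simp only [discrimination]
  refine Finset.expect_congr rfl fun ω _ => ?_
  rw [add_comm (f ω), ← neg_sub, neg_sq]

/-- Passing a fair bit through a symmetric noisy channel scales the discrimination. -/
theorem discrimination_mix (f g : (S → Bool) → ℝ) (θ : ℝ) :
    discrimination (fun ω => (1 + θ) / 2 * f ω + (1 - θ) / 2 * g ω)
      (fun ω => (1 + θ) / 2 * g ω + (1 - θ) / 2 * f ω) = θ ^ 2 * discrimination f g := by
  simp only [discrimination, Finset.mul_expect]
  refine Finset.expect_congr rfl fun ω _ => ?_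
  rw [← mul_div_assoc]
  congr 1 <;> ring

/-- Multiplied by `1 + a * b`, the two sides differ by `(a * b) ^ 2 * (2 - a ^ 2 - b ^ 2) ≥ 0`. The
right side has this form because every mixed term carries an odd power of each variable, and its
expectation will vanish. -/
theorem sq_div_le_of_mem_Icc {a b : ℝ} (ha : |a| ≤ 1) (hb : |b| ≤ 1) :
    (a + b) ^ 2 / (1 + a * b) ≤ a ^ 2 + b ^ 2 + 2 * (a * b) - a ^ 3 * b - a * b ^ 3 := by
  have hab : |a * b| ≤ 1 := by
    rw [abs_mul]
    exact mul_le_one₀ ha (abs_nonneg _) hb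
  have ha2 : a ^ 2 ≤ 1 := (sq_le_one_iff_abs_le_one a).2 ha
  have hb2 : b ^ 2 ≤ 1 := (sq_le_one_iff_abs_le_one b).2 hb
  have h0 : 0 ≤ 1 + a * b := by linarith [neg_abs_le (a * b)]
  rcases h0.eq_or_lt with h | h
  · rw [← h, div_zero]
    have h' : a * b = -1 := by linarith
    nlinarith [sq_nonneg (a + b)]
  · rw [div_le_iff₀ h]
    nlinarith [mul_nonneg (sq_nonneg (a * b)) (by linarith : 0 ≤ 2 - a ^ 2 - b ^ 2)]

/-- The pointwise estimate behind the subadditivity of the discrimination. -/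
theorem sq_sub_mul_div_le {f g f' g' : ℝ} (hf : 0 ≤ f) (hg : 0 ≤ g) (hf' : 0 ≤ f')
    (hg' : 0 ≤ g') :
    (f * f' - g * g') ^ 2 / (2 * (f * f' + g * g')) ≤
      (f - g) ^ 2 / (2 * (f + g)) * ((f' + g') / 2)
      + (f + g) / 2 * ((f' - g') ^ 2 / (2 * (f' + g')))
      + 2 * ((f - g) / 2 * ((f' - g') / 2))
      - (f - g) ^ 3 / (2 * (f + g) ^ 2) * ((f' - g') / 2)
      - (f - g) / 2 * ((f' - g') ^ 3 / (2 * (f' + g') ^ 2)) := by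
  rcases (add_nonneg hf hg).eq_or_lt with h | h
  · have : f = 0 := by linarith
    have : g = 0 := by linarith
    subst f; subst g; simp
  rcases (add_nonneg hf' hg').eq_or_lt with h' | h'
  · have : f' = 0 := by linarith
    have : g' = 0 := by linarith
    subst f'; subst g'; simp
  -- The scalar inequality is applied to the relative differences and then weighted by the product
  -- of the averages.
  have ha : |(f - g) / (f + g)| ≤ 1 := by
    rw [abs_div, abs_of_pos h, div_le_one h, abs_le]
    constructor <;> linarith
  have hb : |(f' - g') / (f' + g')| ≤ 1 := by
    rw [abs_div, abs_of_pos h', div_le_one h', abs_le]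
    constructor <;> linarith
  have key := mul_le_mul_of_nonneg_left (sq_div_le_of_mem_Icc ha hb)
    (by positivity : 0 ≤ (f + g) / 2 * ((f' + g') / 2))
  have h1 : (f + g) / 2 * ((f' + g') / 2) * (((f - g) / (f + g) + (f' - g') / (f' + g')) ^ 2 /
      (1 + (f - g) / (f + g) * ((f' - g') / (f' + g'))))
      = (f * f' - g * g') ^ 2 / (2 * (f * f' + g * g')) := by
    have e1 : (f - g) / (f + g) + (f' - g') / (f' + g')
        = 2 * (f * f' - g * g') / ((f + g) * (f' + g')) := by
      field_simp; ring
    have e2 : 1 + (f - g) / (f + g) * ((f' - g') / (f' + g'))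
        = 2 * (f * f' + g * g') / ((f + g) * (f' + g')) := by
      field_simp; ring
    rw [e1, e2]
    by_cases h0 : f * f' + g * g' = 0
    · simp [h0]
    · field_simp
  rw [h1] at key
  refine key.trans (le_of_eq ?_)
  field_simp

/-- Subadditivity of the discrimination for independent observations. -/
theorem discrimination_mul_le {f g f' g' : (S → Bool) → ℝ} {s t : Set S}
    (hf : DependsOn f s) (hg : DependsOn g s) (hf' : DependsOn f' t) (hg' : DependsOn g' t)
    (hst : Disjoint s t) (f0 : ∀ ω, 0 ≤ f ω) (g0 : ∀ ω, 0 ≤ g ω) (f0' : ∀ ω, 0 ≤ f' ω)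
    (g0' : ∀ ω, 0 ≤ g' ω) (f1 : 𝔼 ω, f ω = 1) (g1 : 𝔼 ω, g ω = 1) (f1' : 𝔼 ω, f' ω = 1)
    (g1' : 𝔼 ω, g' ω = 1) :
    discrimination (fun ω => f ω * f' ω) (fun ω => g ω * g' ω)
      ≤ discrimination f g + discrimination f' g' := by
  have comb : ∀ {u : Set S} {f g : (S → Bool) → ℝ} (F : ℝ → ℝ → ℝ), DependsOn f u →
      DependsOn g u → DependsOn (fun ω => F (f ω) (g ω)) u :=
    fun F h h' x y hxy => by simp only [h hxy, h' hxy]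
  have ind := fun (F G : ℝ → ℝ → ℝ) =>
    expect_mul_of_dependsOn (comb F hf hg) (comb G hf' hg') hst
  -- Equal total masses make the linear differences centred. By independence each mixed term of the
  -- pointwise bound then has a factor with mean zero.
  have hz : 𝔼 ω, (f ω - g ω) / 2 = 0 := by
    rw [← Finset.expect_div, Finset.expect_sub_distrib, f1, g1]; norm_num
  have hz' : 𝔼 ω, (f' ω - g' ω) / 2 = 0 := by
    rw [← Finset.expect_div, Finset.expect_sub_distrib, f1', g1']; norm_num
  have ho : 𝔼 ω, (f ω + g ω) / 2 = 1 := by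
    rw [← Finset.expect_div, Finset.expect_add_distrib, f1, g1]; norm_num
  have ho' : 𝔼 ω, (f' ω + g' ω) / 2 = 1 := by
    rw [← Finset.expect_div, Finset.expect_add_distrib, f1', g1']; norm_num
  have h1 := ind (fun a b => (a - b) ^ 2 / (2 * (a + b))) (fun a b => (a + b) / 2)
  have h2 := ind (fun a b => (a + b) / 2) (fun a b => (a - b) ^ 2 / (2 * (a + b)))
  have h3 := ind (fun a b => (a - b) / 2) (fun a b => (a - b) / 2)
  have h4 := ind (fun a b => (a - b) ^ 3 / (2 * (a + b) ^ 2)) (fun a b => (a - b) / 2)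
  have h5 := ind (fun a b => (a - b) / 2) (fun a b => (a - b) ^ 3 / (2 * (a + b) ^ 2))
  rw [hz'] at h3 h4
  rw [hz] at h5
  rw [ho'] at h1
  rw [ho] at h2
  refine (Finset.expect_le_expect fun ω _ =>
    sq_sub_mul_div_le (f0 ω) (g0 ω) (f0' ω) (g0' ω)).trans (le_of_eq ?_)
  rw [Finset.expect_sub_distrib, Finset.expect_sub_distrib, Finset.expect_add_distrib,
    Finset.expect_add_distrib, ← Finset.mul_expect, h1, h2, h3, h4, h5]
  simp [discrimination]

/-- The `L¹` distance of two densities is controlled by their discrimination. -/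
theorem expect_abs_sub_le {f g : (S → Bool) → ℝ} (f0 : ∀ ω, 0 ≤ f ω) (g0 : ∀ ω, 0 ≤ g ω)
    (f1 : 𝔼 ω, f ω = 1) (g1 : 𝔼 ω, g ω = 1) :
    𝔼 ω, |f ω - g ω| ≤ 2 * √(discrimination f g) := by
  have hc : (0 : ℝ) < Fintype.card (S → Bool) := by exact_mod_cast Fintype.card_pos
  -- Cauchy–Schwarz with weight `2 (f + g)`, of expectation 4. Where the weight vanishes so do both
  -- densities, so division by zero does no harm.
  have cs := Finset.sum_sq_le_sum_mul_sum_of_sq_le_mul Finset.univ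
    (r := fun ω => |f ω - g ω|) (f := fun ω => (f ω - g ω) ^ 2 / (2 * (f ω + g ω)))
    (g := fun ω => 2 * (f ω + g ω))
    (fun ω _ => div_nonneg (sq_nonneg _) (by linarith [f0 ω, g0 ω]))
    (fun ω _ => by linarith [f0 ω, g0 ω])
    (fun ω _ => by
      refine le_of_eq ?_
      rw [sq_abs]
      by_cases h : f ω + g ω = 0
      · have h1 : f ω = 0 := by linarith [f0 ω, g0 ω]
        have h2 : g ω = 0 := by linarith [f0 ω, g0 ω]
        simp [h1, h2]
      · field_simp)
  have hs : (𝔼 ω, |f ω - g ω|) ^ 2 ≤ discrimination f g * 4 := by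
    have h4 : 𝔼 ω, 2 * (f ω + g ω) = 4 := by
      rw [← Finset.mul_expect, Finset.expect_add_distrib, f1, g1]; norm_num
    rw [← h4, discrimination]
    simp only [Fintype.expect_eq_sum_div_card]
    rw [div_pow, div_mul_div_comm, ← sq]
    gcongr
  refine (Real.le_sqrt_of_sq_le hs).trans (le_of_eq ?_)
  rw [Real.sqrt_mul' _ (by norm_num), show (4 : ℝ) = 2 ^ 2 by norm_num,
    Real.sqrt_sq (by norm_num), mul_comm]

end Discrimination

/-! ### Kernels which broadcast bits along a forest -/

namespace NoisyVoter

open scoped BigOperators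

variable {S : Type*} [Fintype S] [DecidableEq S]

/-- Each site keeps its value with probability `(1 + θ) / 2` and flips it otherwise. -/
noncomputable def noiseMatrix (S : Type*) [Fintype S] [DecidableEq S] (θ : ℝ) :
    Matrix (S → Bool) (S → Bool) ℝ :=
  Matrix.of fun η ξ => ∏ x, if ξ x = η x then (1 + θ) / 2 else (1 - θ) / 2

/-- The site `x` adopts the value of the site `y`. -/
def copyMatrix (x y : S) : Matrix (S → Bool) (S → Bool) ℝ :=
  Matrix.of fun η ξ => if ξ = Function.update η x (η y) then 1 else 0

theorem copyMatrix_mul_apply (x y : S) (M : Matrix (S → Bool) (S → Bool) ℝ) (η ω : S → Bool) :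
    (copyMatrix x y * M) η ω = M (Function.update η x (η y)) ω := by
  simp [copyMatrix, Matrix.mul_apply]

/-- A kernel under which the root values are broadcast independently along the trees of a forest
with set of leaves `S`: the root above the leaf `z` is `anc z`, the leaves below the root `x` have
density `dens x b` if `x` has the value `b`, and their discrimination is at most `θ ^ 2` per
leaf. -/
structure ForestData (θ : ℝ) (M : Matrix (S → Bool) (S → Bool) ℝ) (anc : S → S)
    (dens : S → Bool → (S → Bool) → ℝ) : Prop where
  nonneg : ∀ x b ω, 0 ≤ dens x b ω
  dependsOn : ∀ x b, DependsOn (dens x b) {z | anc z = x}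
  expect_eq_one : ∀ x b, 𝔼 ω, dens x b ω = 1
  discrimination_le : ∀ x, discrimination (dens x true) (dens x false)
    ≤ (Finset.univ.filter fun z => anc z = x).card * θ ^ 2
  apply_eq : ∀ η ω, M η ω = (∏ x, dens x (η x) ω) / Fintype.card (S → Bool)

/-- Existence of a representation as broadcasting along a forest. -/
def IsForestKernel (θ : ℝ) (M : Matrix (S → Bool) (S → Bool) ℝ) : Prop :=
  ∃ anc dens, ForestData θ M anc dens

theorem isForestKernel_one : IsForestKernel 1 (1 : Matrix (S → Bool) (S → Bool) ℝ) := by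
  have hexp : ∀ (x : S) (F : Bool → ℝ), 𝔼 ω : S → Bool, F (ω x) = (F true + F false) / 2 := by
    intro x F
    have hinv : Function.Involutive fun ω : S → Bool => flipAt ω x := by
      intro ω
      ext z
      by_cases h : z = x <;> simp [flipAt, h]
    have h1 : 𝔼 ω : S → Bool, F (ω x) = 𝔼 ω : S → Bool, F (!ω x) := by
      refine Fintype.expect_equiv hinv.toPerm _ _ fun ω => ?_
      simp [flipAt]
    have h2 : 𝔼 ω : S → Bool, (F (ω x) + F (!ω x)) = F true + F false := by
      rw [← Fintype.expect_const (ι := S → Bool) (F true + F false)]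
      refine Finset.expect_congr rfl fun ω _ => ?_
      cases ω x <;> simp [add_comm]
    rw [Finset.expect_add_distrib, ← h1] at h2
    linarith
  -- Every site is its own tree. The densities 2 and 0 determine the bit, so the discrimination is
  -- exactly 1.
  refine ⟨id, fun x b ω => if ω x = b then 2 else 0, ?_, ?_, ?_, ?_, ?_⟩
  · intro x b ω
    split_ifs <;> norm_num
  · intro x b ω ω' h
    simp only [h x rfl]
  · intro x b
    rw [hexp x fun c => if c = b then 2 else 0]
    cases b <;> norm_num
  · intro x
    rw [discrimination, hexp x fun c => ((if c = true then 2 else 0) -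
      (if c = false then 2 else 0) : ℝ) ^ 2 / (2 * ((if c = true then 2 else 0) +
      (if c = false then 2 else 0)))]
    norm_num [Finset.filter_eq']
  · intro η ω
    by_cases h : η = ω
    · subst h
      simp
    · obtain ⟨x, hx⟩ := Function.ne_iff.1 h
      rw [Matrix.one_apply_ne h, Finset.prod_eq_zero (Finset.mem_univ x), zero_div]
      simp [Ne.symm hx]

/-- Multiplying on the left puts the noise before the broadcast: it acts on the root bits only, so
the forest is unchanged and each pair of densities is mixed. -/
theorem IsForestKernel.noise_mul {θ : ℝ} {M : Matrix (S → Bool) (S → Bool) ℝ}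
    (hM : IsForestKernel θ M) {c : ℝ} (c0 : 0 ≤ c) (c1 : c ≤ 1) :
    IsForestKernel (c * θ) (noiseMatrix S c * M) := by
  obtain ⟨anc, k, hk⟩ := hM
  refine ⟨anc, fun x b ω => (1 + c) / 2 * k x b ω + (1 - c) / 2 * k x (!b) ω,
    ?_, ?_, ?_, ?_, ?_⟩
  · intro x b ω
    have := hk.nonneg x b ω
    have := hk.nonneg x (!b) ω
    have : 0 ≤ 1 - c := by linarith
    positivity
  · intro x b ω ω' h
    simp only [hk.dependsOn x b h, hk.dependsOn x (!b) h]
  · intro x b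
    rw [Finset.expect_add_distrib, ← Finset.mul_expect, ← Finset.mul_expect,
      hk.expect_eq_one, hk.expect_eq_one]
    ring
  · intro x
    have := mul_le_mul_of_nonneg_left (hk.discrimination_le x) (sq_nonneg c)
    simp only [Bool.not_true, Bool.not_false]
    rw [discrimination_mix]
    refine this.trans (le_of_eq (by ring))
  · intro η ω
    simp only [Matrix.mul_apply, noiseMatrix, Matrix.of_apply, hk.apply_eq]
    simp only [← mul_div_assoc, ← Finset.prod_mul_distrib]
    rw [← Finset.sum_div]
    congr 1
    -- The sum over intermediate configurations factorizes over the sites.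
    have := Finset.prod_univ_sum (fun _ : S => (Finset.univ : Finset Bool))
      (fun x b => (if b = η x then (1 + c) / 2 else (1 - c) / 2) * k x b ω)
    rw [Fintype.piFinset_univ] at this
    rw [← this]
    refine Finset.prod_congr rfl fun x _ => ?_
    cases η x <;> simp [add_comm]

/-- The tree rooted at `x` is grafted onto `y`: both families of leaves now read the bit at `y`, and
no leaf depends on `x`. Leaf counts add, as do the discrimination bounds. -/
theorem IsForestKernel.copy_mul {θ : ℝ} {M : Matrix (S → Bool) (S → Bool) ℝ}
    (hM : IsForestKernel θ M) {x y : S} (hxy : y ≠ x) :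
    IsForestKernel θ (copyMatrix x y * M) := by
  obtain ⟨anc, k, hk⟩ := hM
  have hdisj : Disjoint {z | anc z = x} {z | anc z = y} :=
    Set.disjoint_left.2 fun z (h : anc z = x) (h' : anc z = y) => hxy (h'.symm.trans h)
  refine ⟨fun z => if anc z = x then y else anc z,
    fun z b => if z = x then fun _ => 1 else if z = y then fun ω => k x b ω * k y b ω else k z b,
    ?_, ?_, ?_, ?_, ?_⟩
  · intro z b ω
    split_ifs
    · exact zero_le_one
    · exact mul_nonneg (hk.nonneg _ _ _) (hk.nonneg _ _ _)
    · exact hk.nonneg _ _ _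
  · intro z b ω ω' h
    split_ifs with h1 h2
    · rfl
    · subst h2
      refine congrArg₂ (· * ·) ?_ ?_
      · exact hk.dependsOn x b fun i (hi : anc i = x) => h i (by simp [hi])
      · exact hk.dependsOn z b fun i (hi : anc i = z) => h i (by simp [hi])
    · refine hk.dependsOn z b fun i (hi : anc i = z) => h i ?_
      simp [hi, h1]
  · intro z b
    split_ifs
    · exact Fintype.expect_const _
    · rw [expect_mul_of_dependsOn (hk.dependsOn x b) (hk.dependsOn y b) hdisj,
        hk.expect_eq_one, hk.expect_eq_one, one_mul]
    · exact hk.expect_eq_one _ _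
  · intro z
    by_cases h1 : z = x
    · subst h1
      simp only [if_true, discrimination_self]
      positivity
    by_cases h2 : z = y
    · subst h2
      simp only [if_neg hxy, if_true]
      refine (discrimination_mul_le (hk.dependsOn x true) (hk.dependsOn x false)
        (hk.dependsOn z true) (hk.dependsOn z false) hdisj (hk.nonneg _ _) (hk.nonneg _ _)
        (hk.nonneg _ _) (hk.nonneg _ _) (hk.expect_eq_one _ _) (hk.expect_eq_one _ _)
        (hk.expect_eq_one _ _) (hk.expect_eq_one _ _)).trans ?_
      refine (add_le_add (hk.discrimination_le x) (hk.discrimination_le z)).trans (le_of_eq ?_)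
      rw [← add_mul, ← Nat.cast_add, ← Finset.card_union_of_disjoint]
      · congr 3
        ext i
        by_cases hi : anc i = x <;> simp [hi]
      · refine Finset.disjoint_filter.2 fun i _ h h' => hxy (h'.symm.trans h)
    · simp only [if_neg h1, if_neg h2]
      refine (hk.discrimination_le z).trans (le_of_eq ?_)
      congr 3
      ext i
      by_cases hi : anc i = x
      · simp [hi, Ne.symm h1, Ne.symm h2]
      · simp [hi]
  · intro η ω
    rw [copyMatrix_mul_apply, hk.apply_eq]
    congr 1
    have hy : y ∈ Finset.univ.erase x := by simp [hxy]
    rw [← Finset.mul_prod_erase _ _ (Finset.mem_univ x), ← Finset.mul_prod_erase _ _ hy,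
      ← Finset.mul_prod_erase (a := x) _ _ (Finset.mem_univ x), ← Finset.mul_prod_erase _ _ hy]
    simp only [Function.update_self, Function.update_of_ne hxy, if_true, if_neg hxy, one_mul,
      ← mul_assoc]
    congr 1
    refine Finset.prod_congr rfl fun z hz => ?_
    simp only [Finset.mem_erase] at hz
    rw [Function.update_of_ne hz.2.1, if_neg hz.2.1, if_neg hz.1]

/-- The rows of a forest kernel are close to each other. -/
theorem IsForestKernel.tvDist_le {θ : ℝ} (hθ : 0 ≤ θ) {M : Matrix (S → Bool) (S → Bool) ℝ}
    (hM : IsForestKernel θ M) (η ξ : S → Bool) :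
    tvDist (M η) (M ξ) ≤ √(Fintype.card S) * θ := by
  classical
  obtain ⟨anc, k, hk⟩ := hM
  have hdep : ∀ (η : S → Bool) (s : Finset S),
      DependsOn (fun ω => ∏ x ∈ s, k x (η x) ω) {z | anc z ∈ s} := by
    intro η s ω ω' h
    refine Finset.prod_congr rfl fun x hx => hk.dependsOn x _ fun z (hz : anc z = x) => h z ?_
    simp [hz, hx]
  have hdisj : ∀ {x : S} {s : Finset S}, x ∉ s → Disjoint {z | anc z = x} {z | anc z ∈ s} := by
    intro x s hx
    exact Set.disjoint_left.2 fun z (h : anc z = x) (h' : anc z ∈ s) => hx (h ▸ h')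
  have hnn : ∀ (η : S → Bool) (s : Finset S) (ω), 0 ≤ ∏ x ∈ s, k x (η x) ω :=
    fun η s ω => Finset.prod_nonneg fun x _ => hk.nonneg _ _ _
  have hone : ∀ (η : S → Bool) (s : Finset S), 𝔼 ω, ∏ x ∈ s, k x (η x) ω = 1 := by
    intro η s
    induction s using Finset.induction_on with
    | empty => simp
    | insert x s hx ih =>
      simp only [Finset.prod_insert hx]
      rw [expect_mul_of_dependsOn (hk.dependsOn x _) (hdep η s) (hdisj hx), ih,
        hk.expect_eq_one, one_mul]
  have hsite : ∀ x (b c : Bool), discrimination (k x b) (k x c)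
      ≤ (Finset.univ.filter fun z => anc z = x).card * θ ^ 2 := by
    intro x b c
    have h := hk.discrimination_le x
    have h0 : (0 : ℝ) ≤ (Finset.univ.filter fun z => anc z = x).card * θ ^ 2 := by positivity
    cases b <;> cases c
    · rwa [discrimination_self]
    · rwa [discrimination_comm]
    · exact h
    · rwa [discrimination_self]
  -- Distinct trees have disjoint leaves, so subadditivity applies root by root. The leaf counts
  -- then add up to `|S|`.
  have hsum : ∀ s : Finset S,
      discrimination (fun ω => ∏ x ∈ s, k x (η x) ω) (fun ω => ∏ x ∈ s, k x (ξ x) ω)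
        ≤ ∑ x ∈ s, (Finset.univ.filter fun z => anc z = x).card * θ ^ 2 := by
    intro s
    induction s using Finset.induction_on with
    | empty => simp [discrimination_self]
    | insert x s hx ih =>
      simp only [Finset.prod_insert hx, Finset.sum_insert hx]
      exact (discrimination_mul_le (hk.dependsOn x _) (hk.dependsOn x _) (hdep η s) (hdep ξ s)
        (hdisj hx) (hk.nonneg _ _) (hk.nonneg _ _) (hnn η s) (hnn ξ s) (hk.expect_eq_one _ _)
        (hk.expect_eq_one _ _) (hone η s) (hone ξ s)).trans (add_le_add (hsite _ _ _) ih)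
  have hcard : ∑ x, ((Finset.univ.filter fun z => anc z = x).card : ℝ) = Fintype.card S := by
    rw [← Nat.cast_sum, ← Finset.card_eq_sum_card_fiberwise fun z _ => Finset.mem_univ (anc z),
      Finset.card_univ]
  have hD := hsum Finset.univ
  rw [← Finset.sum_mul, hcard] at hD
  have h := expect_abs_sub_le (hnn η Finset.univ) (hnn ξ Finset.univ) (hone η _) (hone ξ _)
  have htv : tvDist (M η) (M ξ) = 1 / 2 * 𝔼 ω, |∏ x, k x (η x) ω - ∏ x, k x (ξ x) ω| := by
    rw [tvDist, Fintype.expect_eq_sum_div_card, Finset.sum_div]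
    congr 1
    refine Finset.sum_congr rfl fun ω _ => ?_
    rw [hk.apply_eq, hk.apply_eq, ← sub_div, abs_div, Nat.abs_cast]
  calc tvDist (M η) (M ξ) ≤ √(discrimination (fun ω => ∏ x, k x (η x) ω)
        (fun ω => ∏ x, k x (ξ x) ω)) := by rw [htv]; linarith
    _ ≤ √(Fintype.card S * θ ^ 2) := Real.sqrt_le_sqrt hD
    _ = √(Fintype.card S) * θ := by
        rw [Real.sqrt_mul (Nat.cast_nonneg _), Real.sqrt_sq hθ]

end NoisyVoter

/-! ### Exponentials as limits of products -/

theorem norm_pow_sub_pow_le {𝔸 : Type*} [NormedRing 𝔸] [NormOneClass 𝔸] {a b : 𝔸} {M : ℝ}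
    (hM : 1 ≤ M) (ha : ‖a‖ ≤ M) (hb : ‖b‖ ≤ M) (k : ℕ) :
    ‖a ^ k - b ^ k‖ ≤ k * ‖a - b‖ * M ^ k := by
  have hM0 : 0 ≤ M := zero_le_one.trans hM
  induction k with
  | zero => simp
  | succ k ih =>
    have h1 : a ^ (k + 1) - b ^ (k + 1) = a * (a ^ k - b ^ k) + (a - b) * b ^ k := by
      rw [pow_succ', pow_succ']; noncomm_ring
    have h2 : ‖b ^ k‖ ≤ M ^ k := (norm_pow_le b k).trans (pow_le_pow_left₀ (norm_nonneg _) hb k)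
    calc ‖a ^ (k + 1) - b ^ (k + 1)‖
        ≤ ‖a‖ * ‖a ^ k - b ^ k‖ + ‖a - b‖ * ‖b ^ k‖ := by
          rw [h1]
          exact (norm_add_le _ _).trans (add_le_add (norm_mul_le _ _) (norm_mul_le _ _))
      _ ≤ M * (k * ‖a - b‖ * M ^ k) + ‖a - b‖ * (M * M ^ k) := by
          gcongr
          exact h2.trans (le_mul_of_one_le_left (by positivity) hM)
      _ = ((k + 1 : ℕ) : ℝ) * ‖a - b‖ * M ^ (k + 1) := by push_cast; ring

/-- Chernoff's product formula: a one-step error `o(1/k)`, made `k` times while the powers stay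
bounded by `e^{C|t|}`, vanishes in the limit. Any first-order approximation of the semigroup may
thus replace it. -/
theorem tendsto_pow_exp_of_hasDerivAt {𝔸 : Type*} [NormedRing 𝔸] [NormOneClass 𝔸]
    [NormedAlgebra ℝ 𝔸] [CompleteSpace 𝔸] {F : ℝ → 𝔸} {Q : 𝔸} (hF0 : F 0 = 1)
    (hF : HasDerivAt F Q 0) (t : ℝ) :
    Tendsto (fun k : ℕ => F (t / k) ^ k) atTop (𝓝 (NormedSpace.exp (t • Q))) := by
  have hE : HasDerivAt (fun h : ℝ => NormedSpace.exp (h • Q)) Q 0 := by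
    simpa using hasDerivAt_exp_smul_const (𝕂 := ℝ) Q 0
  have hE0 : NormedSpace.exp ((0 : ℝ) • Q) = 1 := by simp
  have hlim : Tendsto (fun k : ℕ => t / k) atTop (𝓝 0) := tendsto_const_div_atTop_nhds_zero_nat t
  have bound : ∀ {G : ℝ → 𝔸}, G 0 = 1 → HasDerivAt G Q 0 →
      ∃ C : ℝ, 0 ≤ C ∧ ∀ᶠ h in 𝓝 (0 : ℝ), ‖G h‖ ≤ 1 + C * |h| := by
    intro G hG0 hG
    obtain ⟨C, hC0, hC⟩ := hG.isBigO_sub.exists_nonneg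
    refine ⟨C, hC0, hC.bound.mono fun h hh => ?_⟩
    rw [hG0, sub_zero, Real.norm_eq_abs] at hh
    calc ‖G h‖ = ‖1 + (G h - 1)‖ := by congr 1; abel
      _ ≤ 1 + C * |h| := (norm_add_le _ _).trans (by rw [norm_one]; gcongr)
  obtain ⟨C₁, hC₁, h₁⟩ := bound hF0 hF
  obtain ⟨C₂, hC₂, h₂⟩ := bound hE0 hE
  have hsmall : Tendsto (fun k : ℕ => k * ‖F (t / k) - NormedSpace.exp ((t / k) • Q)‖) atTop
      (𝓝 0) := by
    have hd := hasDerivAt_iff_isLittleO_nhds_zero.1 (hF.sub hE)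
    have ho := (hd.comp_tendsto hlim).norm_left
    have hO : (fun k : ℕ => ‖F (t / k) - NormedSpace.exp ((t / k) • Q)‖) =o[atTop]
        fun k : ℕ => t / (k : ℝ) := by
      refine ho.congr (fun k => ?_) fun k => rfl
      simp [hF0]
    have h3 := (Asymptotics.isBigO_refl (fun k : ℕ => (k : ℝ)) atTop).mul_isLittleO hO
    have h4 : (fun k : ℕ => (k : ℝ) * (t / k)) =O[atTop] fun _ => (1 : ℝ) := by
      refine Asymptotics.IsBigO.of_bound |t| ?_
      filter_upwards [eventually_gt_atTop 0] with k hk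
      have : (k : ℝ) ≠ 0 := by positivity
      rw [mul_div_cancel₀ _ this]
      simp
    exact (Asymptotics.isLittleO_one_iff ℝ).1 (h3.trans_isBigO h4)
  rw [tendsto_iff_norm_sub_tendsto_zero]
  have hmaj : Tendsto (fun k : ℕ => k * ‖F (t / k) - NormedSpace.exp ((t / k) • Q)‖
      * Real.exp (max C₁ C₂ * |t|)) atTop (𝓝 0) := by
    simpa using hsmall.mul_const (Real.exp (max C₁ C₂ * |t|))
  refine squeeze_zero' (Eventually.of_forall fun _ => norm_nonneg _) ?_ hmaj
  filter_upwards [hlim.eventually h₁, hlim.eventually h₂, eventually_gt_atTop 0] with k hk1 hk2 hk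
  have hk0 : (k : ℝ) ≠ 0 := by positivity
  have hM : (1 : ℝ) ≤ 1 + max C₁ C₂ * |t / k| :=
    le_add_of_nonneg_right (mul_nonneg (hC₁.trans (le_max_left _ _)) (abs_nonneg _))
  have hpow : NormedSpace.exp (t • Q) = NormedSpace.exp ((t / k) • Q) ^ k := by
    let _ : NormedAlgebra ℚ 𝔸 := NormedAlgebra.restrictScalars ℚ ℝ 𝔸
    rw [← NormedSpace.exp_nsmul, ← Nat.cast_smul_eq_nsmul ℝ, smul_smul, mul_div_cancel₀ _ hk0]
  rw [hpow]
  refine (norm_pow_sub_pow_le hM (hk1.trans ?_) (hk2.trans ?_) k).trans ?_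
  · gcongr; exact le_max_left _ _
  · gcongr; exact le_max_right _ _
  · gcongr
    calc (1 + max C₁ C₂ * |t / k|) ^ k ≤ Real.exp (max C₁ C₂ * |t / k|) ^ k := by
          gcongr
          rw [add_comm]
          exact Real.add_one_le_exp _
      _ = Real.exp (max C₁ C₂ * |t|) := by
          rw [← Real.exp_nat_mul, abs_div, Nat.abs_cast]
          congr 1
          field_simp

/-! ### Transition matrices of finite continuous-time chains -/

namespace NoisyVoter

section Chain

variable {Ω : Type*} [Fintype Ω] [DecidableEq Ω]

attribute [local instance] Matrix.linftyOpNormedRing Matrix.linftyOpNormedAlgebra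
  Matrix.linfty_opNormOneClass

theorem hasDerivAt_matrix {F : ℝ → Matrix Ω Ω ℝ} {F' : Matrix Ω Ω ℝ} {t : ℝ} :
    HasDerivAt F F' t ↔ ∀ x y, HasDerivAt (fun h => F h x y) (F' x y) t := by
  constructor
  · intro h x y
    exact (LinearMap.toContinuousLinearMap
      (Matrix.entryLinearMap ℝ ℝ x y)).hasFDerivAt.comp_hasDerivAt t h
  · intro h
    have h1 : HasDerivAt (fun s => ∑ x, ∑ y, F s x y • Matrix.single x y (1 : ℝ))
        (∑ x, ∑ y, F' x y • Matrix.single x y (1 : ℝ)) t :=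
      HasDerivAt.fun_sum fun x _ => HasDerivAt.fun_sum fun y _ => (h x y).smul_const _
    have h2 : ∀ M : Matrix Ω Ω ℝ, ∑ x, ∑ y, M x y • Matrix.single x y (1 : ℝ) = M := by
      intro M
      conv_rhs => rw [Matrix.matrix_eq_sum_single M]
      simp
    simpa only [h2] using h1

theorem tendsto_pow_transition [Nonempty Ω] (r : Ω → Ω → ℝ) {F : ℝ → Matrix Ω Ω ℝ}
    (hF0 : F 0 = 1) (hF : ∀ x y, HasDerivAt (fun h => F h x y) (generator r x y) 0) (t : ℝ)
    (x y : Ω) : Tendsto (fun k : ℕ => (F (t / k) ^ k) x y) atTop (𝓝 (transition r t x y)) := by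
  have h := tendsto_pow_exp_of_hasDerivAt hF0 (hasDerivAt_matrix.2 hF) t
  exact ((LinearMap.toContinuousLinearMap
    (Matrix.entryLinearMap ℝ ℝ x y)).continuous.tendsto _).comp h

theorem hasDerivAt_transition (r : Ω → Ω → ℝ) (t : ℝ) (x y : Ω) :
    HasDerivAt (fun t => transition r t x y) ((transition r t * generator r) x y) t :=
  hasDerivAt_matrix.1 (hasDerivAt_exp_smul_const (𝕂 := ℝ) (generator r) t) x y

theorem hasDerivAt_transition' (r : Ω → Ω → ℝ) (t : ℝ) (x y : Ω) :
    HasDerivAt (fun t => transition r t x y) ((generator r * transition r t) x y) t :=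
  hasDerivAt_matrix.1 (hasDerivAt_exp_smul_const' (𝕂 := ℝ) (generator r) t) x y

end Chain

/-! ### Total variation distance -/

section TotalVariation

variable {Ω : Type*} [Fintype Ω]

theorem tvDist_nonneg (m₁ m₂ : Ω → ℝ) : 0 ≤ tvDist m₁ m₂ :=
  mul_nonneg (by norm_num) (Finset.sum_nonneg fun _ _ => abs_nonneg _)

theorem tvDist_le_one {m₁ m₂ : Ω → ℝ} (h₁ : ∀ x, 0 ≤ m₁ x) (h₂ : ∀ x, 0 ≤ m₂ x)
    (s₁ : ∑ x, m₁ x = 1) (s₂ : ∑ x, m₂ x = 1) : tvDist m₁ m₂ ≤ 1 := by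
  have : ∑ x, |m₁ x - m₂ x| ≤ ∑ x, (m₁ x + m₂ x) := Finset.sum_le_sum fun x _ => by
    rw [abs_le]; constructor <;> linarith [h₁ x, h₂ x]
  rw [Finset.sum_add_distrib, s₁, s₂] at this
  rw [tvDist]
  linarith

/-- Joint convexity of total variation, used both for mixtures of starting states and for mixtures
of kernels. -/
theorem tvDist_sum_mul_le {ι : Type*} [Fintype ι] {w : ι → ℝ} (hw : ∀ i, 0 ≤ w i)
    (hw1 : ∑ i, w i = 1) {m m' : ι → Ω → ℝ} {D : ℝ} (h : ∀ i, tvDist (m i) (m' i) ≤ D) :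
    tvDist (fun x => ∑ i, w i * m i x) (fun x => ∑ i, w i * m' i x) ≤ D := by
  calc tvDist (fun x => ∑ i, w i * m i x) (fun x => ∑ i, w i * m' i x)
      ≤ 1 / 2 * ∑ x, ∑ i, w i * |m i x - m' i x| := by
        rw [tvDist]
        gcongr with x
        rw [← Finset.sum_sub_distrib]
        refine (Finset.abs_sum_le_sum_abs _ _).trans (le_of_eq ?_)
        refine Finset.sum_congr rfl fun i _ => ?_
        rw [← mul_sub, abs_mul, abs_of_nonneg (hw i)]
    _ = ∑ i, w i * tvDist (m i) (m' i) := by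
        rw [Finset.sum_comm, Finset.mul_sum]
        refine Finset.sum_congr rfl fun i _ => ?_
        rw [tvDist, ← Finset.mul_sum]
        ring
    _ ≤ ∑ i, w i * D := by gcongr with i; exacts [hw i, h i]
    _ = D := by rw [← Finset.sum_mul, hw1, one_mul]

theorem eq_of_tvDist_le_zero {m₁ m₂ : Ω → ℝ} (h : tvDist m₁ m₂ ≤ 0) : m₁ = m₂ := by
  have h0 : ∑ x, |m₁ x - m₂ x| = 0 :=
    le_antisymm (by rw [tvDist] at h; linarith) (Finset.sum_nonneg fun _ _ => abs_nonneg _)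
  ext x
  have := (Finset.sum_eq_zero_iff_of_nonneg fun _ _ => abs_nonneg _).1 h0 x (Finset.mem_univ x)
  exact sub_eq_zero.1 (abs_eq_zero.1 this)

/-- Chebyshev's inequality turned into a lower bound on the total variation distance: a function
with mean zero under `m₂`, mean `a` under `m₁`, and variance at most `v` under both. -/
theorem one_sub_le_tvDist {m₁ m₂ : Ω → ℝ} (h₁ : ∀ x, 0 ≤ m₁ x) (h₂ : ∀ x, 0 ≤ m₂ x)
    (s₁ : ∑ x, m₁ x = 1) (s₂ : ∑ x, m₂ x = 1) {f : Ω → ℝ} {a v : ℝ} (ha : 0 < a)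
    (mean₁ : ∑ x, m₁ x * f x = a) (sq₁ : ∑ x, m₁ x * f x ^ 2 ≤ a ^ 2 + v)
    (sq₂ : ∑ x, m₂ x * f x ^ 2 ≤ v) : 1 - 8 * v / a ^ 2 ≤ tvDist m₁ m₂ := by
  have hpt : ∀ x, m₁ x * (1 - 4 * (f x - a) ^ 2 / a ^ 2) - m₂ x * (4 * f x ^ 2 / a ^ 2)
      ≤ (m₁ x - m₂ x + |m₁ x - m₂ x|) / 2 := by
    intro x
    have hu : 0 ≤ 4 * (f x - a) ^ 2 / a ^ 2 := by positivity
    have hw : 0 ≤ 4 * f x ^ 2 / a ^ 2 := by positivity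
    -- No value is within `a / 2` of both 0 and `a`, so at least one of the two Chebyshev weights
    -- reaches 1.
    have huw : 1 ≤ 4 * (f x - a) ^ 2 / a ^ 2 ∨ 1 ≤ 4 * f x ^ 2 / a ^ 2 := by
      by_contra! hcon
      have e1 := (div_lt_one (by positivity)).1 hcon.1
      have e2 := (div_lt_one (by positivity)).1 hcon.2
      nlinarith [sq_nonneg (2 * f x - a)]
    have g₁ := mul_nonneg (h₁ x) hu
    have g₂ := mul_nonneg (h₂ x) hw
    have p₁ : m₁ x - m₂ x ≤ |m₁ x - m₂ x| := le_abs_self _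
    have p₂ : -(m₁ x - m₂ x) ≤ |m₁ x - m₂ x| := neg_le_abs _
    rcases huw with h | h
    · have := mul_le_mul_of_nonneg_left h (h₁ x)
      linarith
    · have := mul_le_mul_of_nonneg_left h (h₂ x)
      linarith
  have hsum := Finset.sum_le_sum fun x (_ : x ∈ Finset.univ) => hpt x
  -- As the masses agree, total variation is the sum of the positive parts.
  have hR : ∑ x, (m₁ x - m₂ x + |m₁ x - m₂ x|) / 2 = tvDist m₁ m₂ := by
    rw [← Finset.sum_div, Finset.sum_add_distrib, Finset.sum_sub_distrib, s₁, s₂, tvDist]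
    ring
  have hL : ∑ x, (m₁ x * (1 - 4 * (f x - a) ^ 2 / a ^ 2) - m₂ x * (4 * f x ^ 2 / a ^ 2))
      = 1 - 4 / a ^ 2 * (∑ x, m₁ x * f x ^ 2 - a ^ 2) - 4 / a ^ 2 * ∑ x, m₂ x * f x ^ 2 := by
    have e : ∑ x, m₁ x * (f x - a) ^ 2 = ∑ x, m₁ x * f x ^ 2 - a ^ 2 := by
      have : ∀ x, m₁ x * (f x - a) ^ 2 = m₁ x * f x ^ 2 - 2 * a * (m₁ x * f x) + a ^ 2 * m₁ x :=
        fun x => by ring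
      simp only [this, Finset.sum_add_distrib, Finset.sum_sub_distrib, ← Finset.mul_sum, mean₁, s₁]
      ring
    rw [← e, Finset.mul_sum, Finset.mul_sum, ← s₁, ← Finset.sum_sub_distrib,
      ← Finset.sum_sub_distrib]
    refine Finset.sum_congr rfl fun x _ => ?_
    rw [s₁]
    field_simp
  rw [hR, hL] at hsum
  refine le_trans ?_ hsum
  have e1 : 4 / a ^ 2 * (∑ x, m₁ x * f x ^ 2 - a ^ 2) ≤ 4 / a ^ 2 * v := by
    gcongr; linarith
  have e2 : 4 / a ^ 2 * ∑ x, m₂ x * f x ^ 2 ≤ 4 / a ^ 2 * v := by gcongr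
  have e3 : 8 * v / a ^ 2 = 4 / a ^ 2 * v + 4 / a ^ 2 * v := by ring
  linarith

end TotalVariation

/-! ### Markov semigroups on a finite set -/

section Semigroup

variable {Ω : Type*} [Fintype Ω] [DecidableEq Ω]

theorem transition_zero (r : Ω → Ω → ℝ) : transition r 0 = 1 := by
  simp [transition]

theorem sum_generator (r : Ω → Ω → ℝ) (x : Ω) : ∑ y, generator r x y = 0 := by
  rw [← Finset.add_sum_erase _ _ (Finset.mem_univ x)]
  have : ∑ y ∈ Finset.univ.erase x, generator r x y = exitRate r x :=
    Finset.sum_congr rfl fun y hy => by simp [generator, (Finset.ne_of_mem_erase hy).symm]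
  rw [this]
  simp [generator]

/-- Kolmogorov's forward equation, tested against a function. -/
theorem hasDerivAt_sum_transition_mul (r : Ω → Ω → ℝ) (f : Ω → ℝ) (x : Ω) (t : ℝ) :
    HasDerivAt (fun t => ∑ y, transition r t x y * f y)
      (∑ y, transition r t x y * ∑ z, generator r y z * f z) t := by
  have h : HasDerivAt (fun t => ∑ y, transition r t x y * f y)
      (∑ y, (transition r t * generator r) x y * f y) t :=
    HasDerivAt.fun_sum fun y _ => (hasDerivAt_transition r t x y).mul_const _
  convert h using 1
  simp only [Matrix.mul_apply, Finset.mul_sum, Finset.sum_mul, mul_assoc]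
  exact Finset.sum_comm

theorem sum_transition (r : Ω → Ω → ℝ) (t : ℝ) (x : Ω) : ∑ y, transition r t x y = 1 := by
  have h := fun t => hasDerivAt_sum_transition_mul r (fun _ => 1) x t
  simp only [mul_one, sum_generator, mul_zero, Finset.sum_const_zero] at h
  rw [is_const_of_deriv_eq_zero (fun t => (h t).differentiableAt) (fun t => (h t).deriv) t 0,
    transition_zero]
  simp [Matrix.one_apply]

/-- The Euler steps `1 + (t/k) Q` are entrywise nonnegative for large `k`, and so are their powers
and the limit. -/
theorem transition_nonneg {r : Ω → Ω → ℝ} (hr : ∀ x y, x ≠ y → 0 ≤ r x y) {t : ℝ} (ht : 0 ≤ t)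
    (x y : Ω) : 0 ≤ transition r t x y := by
  have : Nonempty Ω := ⟨x⟩
  have hF := tendsto_pow_transition r (F := fun h => 1 + h • generator r) (by simp)
    (fun i j => by
      simpa using ((hasDerivAt_id (0 : ℝ)).mul_const (generator r i j)).const_add
        ((1 : Matrix Ω Ω ℝ) i j)) t x y
  have hpow : ∀ (M : Matrix Ω Ω ℝ), (∀ i j, 0 ≤ M i j) → ∀ (k : ℕ) i j, 0 ≤ (M ^ k) i j := by
    intro M hM k
    induction k with
    | zero => intro i j; rw [pow_zero, Matrix.one_apply]; split_ifs <;> norm_num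
    | succ k ih =>
      intro i j
      rw [pow_succ, Matrix.mul_apply]
      exact Finset.sum_nonneg fun l _ => mul_nonneg (ih i l) (hM l j)
  refine ge_of_tendsto hF ?_
  have hsmall : ∀ i : Ω, ∀ᶠ k : ℕ in atTop, t / k * exitRate r i < 1 := fun i => by
    have := (tendsto_const_div_atTop_nhds_zero_nat t).mul_const (exitRate r i)
    rw [zero_mul] at this
    exact this.eventually (gt_mem_nhds zero_lt_one)
  filter_upwards [eventually_all.2 hsmall] with k hk
  refine hpow _ (fun i j => ?_) k x y
  by_cases hij : i = j
  · subst hij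
    simp [generator]
    linarith [hk i]
  · simp [generator, hij]
    exact mul_nonneg (by positivity) (hr i j hij)

theorem exitRate_le_maxExitRate (r : Ω → Ω → ℝ) (x : Ω) : exitRate r x ≤ maxExitRate r :=
  le_ciSup (Set.finite_range _).bddAbove x

/-- A stationary distribution is annihilated by the generator. -/
theorem IsStationary.sum_mul_generator {r : Ω → Ω → ℝ} {π : Ω → ℝ} (h : IsStationary r π)
    (y : Ω) : ∑ x, π x * generator r x y = 0 := by
  have h1 : HasDerivAt (fun t => ∑ x, π x * transition r t x y)
      (∑ x, π x * generator r x y) 0 := by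
    refine HasDerivAt.fun_sum fun x _ => HasDerivAt.const_mul _ ?_
    simpa [transition_zero] using hasDerivAt_transition r 0 x y
  -- Invariance is known for `t ≥ 0` only, hence the one-sided derivative.
  have h2 : HasDerivWithinAt (fun t => ∑ x, π x * transition r t x y) 0 (Set.Ici 0) 0 := by
    refine (hasDerivWithinAt_const (0 : ℝ) _ (π y)).congr (fun t ht => ?_) ?_
    · exact congrFun (h.invariant t ht) y
    · exact congrFun (h.invariant 0 le_rfl) y
  exact (uniqueDiffOn_Ici (0 : ℝ) 0 Set.self_mem_Ici).eq_deriv _ h1.hasDerivWithinAt h2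

theorem IsStationary.sum_mul_sum_generator {r : Ω → Ω → ℝ} {π : Ω → ℝ} (h : IsStationary r π)
    (f : Ω → ℝ) : ∑ x, π x * ∑ y, generator r x y * f y = 0 := by
  simp only [Finset.mul_sum, ← mul_assoc]
  rw [Finset.sum_comm]
  simp only [← Finset.sum_mul, h.sum_mul_generator, zero_mul, Finset.sum_const_zero]

/-- The generator kills constants, so it also has a nonzero left null vector `v`, possibly signed.
The semigroup fixes `v`, so `|v| ≤ |v| Pᵗ`. Both sides have the same total mass, so they agree and
`|v|` can be normalized. -/
theorem exists_isStationary [Nonempty Ω] {r : Ω → Ω → ℝ} (hr : ∀ x y, x ≠ y → 0 ≤ r x y) :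
    ∃ π, IsStationary r π := by
  obtain ⟨v, hv0, hv⟩ : ∃ v, v ≠ 0 ∧ Matrix.vecMul v (generator r) = 0 := by
    refine Matrix.exists_vecMul_eq_zero_iff.2 (Matrix.exists_mulVec_eq_zero_iff.1 ⟨1, one_ne_zero, ?_⟩)
    ext x
    simpa [Matrix.mulVec, dotProduct] using sum_generator r x
  have hvP : ∀ t y, ∑ x, v x * transition r t x y = v y := by
    intro t y
    have h : ∀ t, HasDerivAt (fun t => ∑ x, v x * transition r t x y) 0 t := by
      intro t
      have h1 : HasDerivAt (fun t => ∑ x, v x * transition r t x y)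
          (∑ x, v x * (generator r * transition r t) x y) t :=
        HasDerivAt.fun_sum fun x _ => (hasDerivAt_transition' r t x y).const_mul _
      convert h1 using 1
      have h2 := congrFun (Matrix.vecMul_vecMul v (generator r) (transition r t)) y
      rw [hv] at h2
      simpa [Matrix.vecMul, dotProduct] using h2
    rw [is_const_of_deriv_eq_zero (fun t => (h t).differentiableAt) (fun t => (h t).deriv) t 0,
      transition_zero]
    simp [Matrix.one_apply]
  have habs : ∀ t, 0 ≤ t → ∀ y, ∑ x, |v x| * transition r t x y = |v y| := by
    intro t ht y
    have hle : ∀ y ∈ Finset.univ, |v y| ≤ ∑ x, |v x| * transition r t x y := by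
      intro y _
      rw [← hvP t y]
      refine (Finset.abs_sum_le_sum_abs _ _).trans (le_of_eq ?_)
      refine Finset.sum_congr rfl fun x _ => ?_
      rw [abs_mul, abs_of_nonneg (transition_nonneg hr ht x y)]
    have hsum : ∑ y, |v y| = ∑ y, ∑ x, |v x| * transition r t x y := by
      rw [Finset.sum_comm]
      simp only [← Finset.mul_sum, sum_transition, mul_one]
    exact ((Finset.sum_eq_sum_iff_of_le hle).1 hsum y (Finset.mem_univ y)).symm
  have hpos : 0 < ∑ x, |v x| := by
    obtain ⟨x, hx⟩ := Function.ne_iff.1 hv0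
    exact Finset.sum_pos' (fun _ _ => abs_nonneg _) ⟨x, Finset.mem_univ x, abs_pos.2 hx⟩
  refine ⟨fun x => |v x| / ∑ x, |v x|, fun x => by positivity, ?_, fun t ht => ?_⟩
  · rw [← Finset.sum_div, div_self hpos.ne']
  · ext y
    simp only [Matrix.vecMul, dotProduct, div_mul_eq_mul_div, ← Finset.sum_div, habs t ht y]

theorem IsStationary.sum_mul_transition {r : Ω → Ω → ℝ} {π : Ω → ℝ} (h : IsStationary r π)
    {t : ℝ} (ht : 0 ≤ t) : (fun y => ∑ x, π x * transition r t x y) = π :=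
  h.invariant t ht

theorem IsStationary.tvDist_law_le {r : Ω → Ω → ℝ} {π : Ω → ℝ} (h : IsStationary r π)
    {t D : ℝ} (ht : 0 ≤ t) (hD : ∀ x y, tvDist (law r x t) (law r y t) ≤ D) (x : Ω) :
    tvDist (law r x t) π ≤ D := by
  have key := tvDist_sum_mul_le h.nonneg h.sum_eq_one (m := fun _ => law r x t)
    (m' := fun y => law r y t) (hD x)
  simp only [← Finset.sum_mul, h.sum_eq_one, one_mul] at key
  rwa [show (fun z => ∑ y, π y * law r y t z) = π from h.sum_mul_transition ht] at key

theorem IsStationary.tvDist_le {r : Ω → Ω → ℝ} {π ν : Ω → ℝ} (h : IsStationary r π)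
    (h' : IsStationary r ν) {t D : ℝ} (ht : 0 ≤ t)
    (hD : ∀ x y, tvDist (law r x t) (law r y t) ≤ D) : tvDist ν π ≤ D := by
  have key := tvDist_sum_mul_le h'.nonneg h'.sum_eq_one (m := fun y => law r y t)
    (m' := fun _ => π) (h.tvDist_law_le ht hD)
  simp only [← Finset.sum_mul, h'.sum_eq_one, one_mul] at key
  rwa [show (fun z => ∑ y, ν y * law r y t z) = ν from h'.sum_mul_transition ht] at key

theorem tvDist_le_worstDist (r : Ω → Ω → ℝ) (π : Ω → ℝ) (t : ℝ) (x : Ω) :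
    tvDist (law r x t) π ≤ worstDist r π t :=
  le_ciSup (f := fun x => tvDist (law r x t) π) (Set.finite_range _).bddAbove x

theorem worstDist_nonneg (r : Ω → Ω → ℝ) (π : Ω → ℝ) (t : ℝ) : 0 ≤ worstDist r π t :=
  Real.iSup_nonneg fun _ => tvDist_nonneg _ _

theorem IsStationary.worstDist_le_one [Nonempty Ω] {r : Ω → Ω → ℝ}
    (hr : ∀ x y, x ≠ y → 0 ≤ r x y) {π : Ω → ℝ} (h : IsStationary r π) {t : ℝ} (ht : 0 ≤ t) :
    worstDist r π t ≤ 1 :=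
  ciSup_le fun x => tvDist_le_one (transition_nonneg hr ht x) h.nonneg (sum_transition r t x)
    h.sum_eq_one

end Semigroup

end NoisyVoter

/-! ### The noisy voter model -/

namespace NoisyVoter

section Flip

variable {S : Type*} [DecidableEq S]

theorem flipAt_apply_self (η : S → Bool) (x : S) : flipAt η x x = !η x := by
  simp [flipAt]

theorem flipAt_ne (η : S → Bool) (x : S) : flipAt η x ≠ η := fun h => by
  simpa [flipAt] using congrFun h x

end Flip

section Model

variable {S : Type*} [Fintype S] [DecidableEq S]

theorem flipRate_nonneg {q : S → S → ℝ} (hq : ∀ x y, x ≠ y → 0 ≤ q x y) (η : S → Bool) (x : S) :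
    0 ≤ flipRate q η x := by
  refine add_nonneg (by norm_num) (Finset.sum_nonneg fun y hy => ?_)
  split_ifs
  · exact hq x y (Finset.ne_of_mem_erase hy).symm
  · exact le_rfl

theorem flipRate_le {q : S → S → ℝ} (hq : ∀ x y, x ≠ y → 0 ≤ q x y) (η : S → Bool) (x : S) :
    flipRate q η x ≤ 1 / 2 + exitRate q x := by
  refine add_le_add_right (Finset.sum_le_sum fun y hy => ?_) _
  split_ifs
  · exact le_rfl
  · exact hq x y (Finset.ne_of_mem_erase hy).symm

theorem rate_nonneg {q : S → S → ℝ} (hq : ∀ x y, x ≠ y → 0 ≤ q x y) (η ξ : S → Bool) :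
    0 ≤ rate q η ξ := by
  refine Finset.sum_nonneg fun x _ => ?_
  split_ifs
  · exact flipRate_nonneg hq η x
  · exact le_rfl

theorem generator_rate_apply (q : S → S → ℝ) (η ξ : S → Bool) :
    generator (rate q) η ξ =
      ∑ x, flipRate q η x * ((if ξ = flipAt η x then 1 else 0) - if ξ = η then 1 else 0) := by
  by_cases h : ξ = η
  · subst h
    have h1 : exitRate (rate q) ξ = ∑ x, flipRate q ξ x := by
      simp only [exitRate, rate]
      rw [Finset.sum_comm]
      refine Finset.sum_congr rfl fun x _ => ?_
      rw [Finset.sum_ite_eq' _ _ fun _ => flipRate q ξ x, if_pos (by simp [flipAt_ne])]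
    simp [generator, h1, (flipAt_ne ξ _).symm]
  · simp [generator, h, Ne.symm h, rate]

theorem sum_generator_rate_mul (q : S → S → ℝ) (f : (S → Bool) → ℝ) (η : S → Bool) :
    ∑ ξ, generator (rate q) η ξ * f ξ = ∑ x, flipRate q η x * (f (flipAt η x) - f η) := by
  simp only [generator_rate_apply, Finset.sum_mul]
  rw [Finset.sum_comm]
  refine Finset.sum_congr rfl fun x _ => ?_
  simp only [mul_assoc, ← Finset.mul_sum, sub_mul, Finset.sum_sub_distrib]
  simp

/-! #### Approximation by products of noise and copying steps -/

/-- The generator of the voter dynamics without noise. -/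
noncomputable def voterGenerator (q : S → S → ℝ) : Matrix (S → Bool) (S → Bool) ℝ :=
  ∑ p : S × S, (if p.1 = p.2 then 0 else q p.1 p.2) • (copyMatrix p.1 p.2 - 1)

theorem copyMatrix_self (x : S) : copyMatrix x x = 1 := by
  ext η ξ
  simp [copyMatrix, Matrix.one_apply, eq_comm]

theorem noiseMatrix_one : noiseMatrix S 1 = 1 := by
  ext η ξ
  by_cases h : η = ξ
  · subst h
    simp [noiseMatrix]
  · obtain ⟨x, hx⟩ := Function.ne_iff.1 h
    rw [Matrix.one_apply_ne h, noiseMatrix, Matrix.of_apply]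
    exact Finset.prod_eq_zero (Finset.mem_univ x) (by simp [Ne.symm hx])

/-- At `h = 0` a disagreeing site contributes the factor 0, so only pairs differing at no more than
one site have a nonzero derivative. -/
theorem hasDerivAt_noiseMatrix (η ξ : S → Bool) :
    HasDerivAt (fun h => noiseMatrix S (1 - h) η ξ)
      (∑ x, 1 / 2 * ((if ξ = flipAt η x then 1 else 0) - if ξ = η then 1 else 0)) 0 := by
  have h1 : ∀ x ∈ Finset.univ, HasDerivAt
      (fun h : ℝ => if ξ x = η x then (1 + (1 - h)) / 2 else (1 - (1 - h)) / 2)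
      (if ξ x = η x then -1 / 2 else 1 / 2) 0 := by
    intro x _
    have hd := (hasDerivAt_id (0 : ℝ)).const_sub 1
    split_ifs
    · simpa using (hd.const_add 1).div_const 2
    · simpa using (hd.const_sub 1).div_const 2
  have h2 := HasDerivAt.fun_finsetProd h1
  simp only [noiseMatrix, Matrix.of_apply]
  refine h2.congr_deriv ?_
  refine Finset.sum_congr rfl fun x _ => ?_
  by_cases hex : ∃ z, z ≠ x ∧ ξ z ≠ η z
  · obtain ⟨z, hz, hne⟩ := hex
    have e1 : ξ ≠ η := fun h => hne (congrFun h z)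
    have e2 : ξ ≠ flipAt η x := fun h => hne (by rw [h, flipAt, Function.update_of_ne hz])
    rw [Finset.prod_eq_zero (Finset.mem_erase.2 ⟨hz, Finset.mem_univ z⟩) (by simp [hne])]
    simp [e1, e2]
  · push Not at hex
    rw [Finset.prod_eq_one fun z hz => by
      rw [if_pos (hex z (Finset.ne_of_mem_erase hz))]; norm_num]
    by_cases hx : ξ x = η x
    · have e1 : ξ = η := funext fun z => by
        by_cases hz : z = x
        · rw [hz, hx]
        · exact hex z hz
      subst e1
      simp [(flipAt_ne ξ x).symm]
      norm_num
    · have e1 : ξ = flipAt η x := funext fun z => by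
        by_cases hz : z = x
        · subst hz
          rw [flipAt_apply_self]
          revert hx
          cases ξ z <;> cases η z <;> simp
        · rw [flipAt, Function.update_of_ne hz, hex z hz]
      have e2 : ξ ≠ η := fun h => hx (congrFun h x)
      simp [← e1, e2, hx]

/-- Copying from `y` to `x` does nothing when the bits agree and is the flip at `x` otherwise. -/
theorem voterGenerator_apply (q : S → S → ℝ) (η ξ : S → Bool) :
    voterGenerator q η ξ = ∑ x, (flipRate q η x - 1 / 2) *
      ((if ξ = flipAt η x then 1 else 0) - if ξ = η then 1 else 0) := by
  have hcopy : ∀ x y, (copyMatrix x y - 1) η ξ = if η y ≠ η x then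
      (if ξ = flipAt η x then (1 : ℝ) else 0) - (if ξ = η then 1 else 0) else 0 := by
    intro x y
    simp only [Matrix.sub_apply, copyMatrix, Matrix.of_apply, Matrix.one_apply]
    by_cases hxy : η y = η x
    · simp [hxy, eq_comm]
    · have : η y = !η x := by
        revert hxy
        cases η y <;> cases η x <;> simp
      rw [if_pos hxy, show Function.update η x (η y) = flipAt η x by rw [this, flipAt]]
      simp [eq_comm (a := η)]
  simp only [voterGenerator, Matrix.sum_apply, Matrix.smul_apply, hcopy, smul_eq_mul,
    Fintype.sum_prod_type, flipRate, add_sub_cancel_left, Finset.sum_mul]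
  refine Finset.sum_congr rfl fun x _ => ?_
  rw [← Finset.add_sum_erase _ _ (Finset.mem_univ x)]
  simp only [if_true, zero_mul, zero_add]
  refine Finset.sum_congr rfl fun y hy => ?_
  rw [if_neg (Finset.ne_of_mem_erase hy).symm]
  split_ifs <;> simp

/-- One step of length `h` of the splitting scheme: noise at all sites, then a voter step. -/
noncomputable def splitStep (q : S → S → ℝ) (h : ℝ) : Matrix (S → Bool) (S → Bool) ℝ :=
  noiseMatrix S (1 - h) * (1 + h • voterGenerator q)

attribute [local instance] Matrix.linftyOpNormedRing Matrix.linftyOpNormedAlgebra in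
theorem hasDerivAt_splitStep (q : S → S → ℝ) (η ξ : S → Bool) :
    HasDerivAt (fun h => splitStep q h η ξ) (generator (rate q) η ξ) 0 := by
  have h1 : HasDerivAt (fun h => noiseMatrix S (1 - h)) (Matrix.of fun η ξ =>
      ∑ x, 1 / 2 * ((if ξ = flipAt η x then 1 else 0) - if ξ = η then 1 else 0)) (0 : ℝ) :=
    hasDerivAt_matrix.2 hasDerivAt_noiseMatrix
  have h2 : HasDerivAt (fun h : ℝ => 1 + h • voterGenerator q) (voterGenerator q) 0 := by
    refine hasDerivAt_matrix.2 fun η ξ => ?_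
    simpa using ((hasDerivAt_id (0 : ℝ)).mul_const (voterGenerator q η ξ)).const_add
      ((1 : Matrix (S → Bool) (S → Bool) ℝ) η ξ)
  have h3 := hasDerivAt_matrix.1 (h1.mul h2) η ξ
  refine h3.congr_deriv ?_
  rw [sub_zero, noiseMatrix_one, zero_smul, add_zero, mul_one, one_mul, Matrix.add_apply,
    Matrix.of_apply, voterGenerator_apply, generator_rate_apply, ← Finset.sum_add_distrib]
  refine Finset.sum_congr rfl fun x _ => ?_
  ring

/-- For small `h` the voter step is a convex combination of the identity and the copying steps.
Linear maps respect convex hulls, so the two closure properties of forest kernels pass to mixtures.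
-/
theorem mem_convexHull_splitStep_mul {q : S → S → ℝ} (hq : ∀ x y, x ≠ y → 0 ≤ q x y) {h θ : ℝ}
    (h0 : 0 ≤ h) (h1 : h ≤ 1)
    (hh : h * ∑ p : S × S, (if p.1 = p.2 then 0 else q p.1 p.2) ≤ 1)
    {M : Matrix (S → Bool) (S → Bool) ℝ} (hM : M ∈ convexHull ℝ {M | IsForestKernel θ M}) :
    splitStep q h * M ∈ convexHull ℝ {M | IsForestKernel ((1 - h) * θ) M} := by
  have voter : ∀ M, IsForestKernel θ M →
      (1 + h • voterGenerator q) * M ∈ convexHull ℝ {M | IsForestKernel θ M} := by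
    intro M hM
    let w : Option (S × S) → ℝ := fun o => o.elim
      (1 - h * ∑ p : S × S, if p.1 = p.2 then 0 else q p.1 p.2)
      fun p => h * if p.1 = p.2 then 0 else q p.1 p.2
    let K : Option (S × S) → Matrix (S → Bool) (S → Bool) ℝ := fun o => o.elim M
      fun p => copyMatrix p.1 p.2 * M
    have hsum : (1 + h • voterGenerator q) * M = ∑ o, w o • K o := by
      simp only [Fintype.sum_option, w, K, Option.elim, voterGenerator, add_mul, one_mul,
        smul_mul_assoc, Finset.sum_mul, Finset.smul_sum, sub_mul, smul_sub, sub_smul,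
        Finset.sum_sub_distrib, mul_smul, Finset.sum_smul, one_smul]
      abel
    rw [hsum]
    refine (convex_convexHull ℝ _).sum_mem ?_ ?_ ?_
    · rintro (_ | ⟨x, y⟩) _
      · exact sub_nonneg.2 hh
      · refine mul_nonneg h0 ?_
        dsimp only
        split_ifs with hxy
        · exact le_rfl
        · exact hq x y hxy
    · simp [Fintype.sum_option, w, Finset.mul_sum]
    · rintro (_ | ⟨x, y⟩) _
      · exact subset_convexHull ℝ _ hM
      · refine subset_convexHull ℝ _ ?_
        change IsForestKernel θ (copyMatrix x y * M)
        by_cases hxy : y = x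
        · rw [hxy, copyMatrix_self, one_mul]
          exact hM
        · exact hM.copy_mul hxy
  have noise : ∀ M ∈ convexHull ℝ {M | IsForestKernel θ M},
      noiseMatrix S (1 - h) * M ∈ convexHull ℝ {M | IsForestKernel ((1 - h) * θ) M} := by
    intro M hM
    refine convexHull_min (t := (LinearMap.mulLeft ℝ (noiseMatrix S (1 - h))) ⁻¹' _) ?_ ?_ hM
    · intro M hM
      exact subset_convexHull ℝ _ (hM.noise_mul (sub_nonneg.2 h1) (by linarith))
    · exact (convex_convexHull ℝ _).linear_preimage _
  rw [splitStep, mul_assoc]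
  refine noise _ ?_
  refine convexHull_min (t := (LinearMap.mulLeft ℝ (1 + h • voterGenerator q)) ⁻¹' _) ?_ ?_ hM
  · exact fun M hM => voter M hM
  · exact (convex_convexHull ℝ _).linear_preimage _

theorem tvDist_le_of_mem_convexHull {θ : ℝ} (hθ : 0 ≤ θ) {M : Matrix (S → Bool) (S → Bool) ℝ}
    (hM : M ∈ convexHull ℝ {M | IsForestKernel θ M}) (η ξ : S → Bool) :
    tvDist (M η) (M ξ) ≤ √(Fintype.card S) * θ := by
  refine convexHull_min (t := {M : Matrix (S → Bool) (S → Bool) ℝ |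
      tvDist (M η) (M ξ) ≤ √(Fintype.card S) * θ})
    (fun M (hM : IsForestKernel θ M) => hM.tvDist_le hθ η ξ) ?_ hM
  intro M hM N hN a b ha hb hab
  have := tvDist_sum_mul_le (w := ![a, b]) (m := ![M η, N η]) (m' := ![M ξ, N ξ])
    (D := √(Fintype.card S) * θ) (by simp [Fin.forall_fin_two, ha, hb]) (by simp [hab])
    (by simpa [Fin.forall_fin_two] using ⟨hM, hN⟩)
  simp only [Fin.sum_univ_two] at this
  exact this

/-- Two copies of the noisy voter model are at distance at most `√|S| e⁻ᵗ` at time `t`,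
whatever the voting mechanism is. -/
theorem tvDist_law_law_le {q : S → S → ℝ} (hq : ∀ x y, x ≠ y → 0 ≤ q x y) {t : ℝ} (ht : 0 ≤ t)
    (η ξ : S → Bool) :
    tvDist (law (rate q) η t) (law (rate q) ξ t) ≤ √(Fintype.card S) * Real.exp (-t) := by
  have hF := tendsto_pow_transition (rate q) (F := splitStep q)
    (by simp [splitStep, noiseMatrix_one]) (hasDerivAt_splitStep q) t
  have hlim : Tendsto (fun k : ℕ => tvDist ((splitStep q (t / k) ^ k) η)
      ((splitStep q (t / k) ^ k) ξ)) atTop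
      (𝓝 (tvDist (law (rate q) η t) (law (rate q) ξ t))) :=
    (tendsto_finsetSum _ fun ω _ => ((hF η ω).sub (hF ξ ω)).abs).const_mul _
  have hexp : Tendsto (fun k : ℕ => √(Fintype.card S) * (1 - t / k) ^ k) atTop
      (𝓝 (√(Fintype.card S) * Real.exp (-t))) := by
    refine ((Real.tendsto_one_add_div_pow_exp (-t)).congr fun k => ?_).const_mul _
    rw [neg_div, ← sub_eq_add_neg]
  refine le_of_tendsto_of_tendsto hlim hexp ?_
  have hzero := tendsto_const_div_atTop_nhds_zero_nat t
  have hsmall : ∀ᶠ k : ℕ in atTop, t / k < 1 := hzero.eventually (gt_mem_nhds zero_lt_one)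
  have hsmall' : ∀ᶠ k : ℕ in atTop,
      t / k * ∑ p : S × S, (if p.1 = p.2 then 0 else q p.1 p.2) < 1 := by
    have := hzero.mul_const (∑ p : S × S, (if p.1 = p.2 then 0 else q p.1 p.2))
    rw [zero_mul] at this
    exact this.eventually (gt_mem_nhds zero_lt_one)
  filter_upwards [hsmall, hsmall'] with k hk hk'
  -- New steps are multiplied on the left: the forest grows backwards in time, from the leaves to
  -- the roots.
  have hmem : ∀ m : ℕ, splitStep q (t / k) ^ m ∈
      convexHull ℝ {M | IsForestKernel ((1 - t / k) ^ m) M} := by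
    intro m
    induction m with
    | zero => exact subset_convexHull ℝ _ (by simpa using isForestKernel_one)
    | succ m ih =>
      rw [pow_succ', pow_succ']
      exact mem_convexHull_splitStep_mul hq (by positivity) hk.le hk'.le ih
  exact tvDist_le_of_mem_convexHull (pow_nonneg (sub_nonneg.2 hk.le) k) (hmem k) η ξ

theorem worstDist_le {q : S → S → ℝ} (hq : ∀ x y, x ≠ y → 0 ≤ q x y) {μ : (S → Bool) → ℝ}
    (hμ : IsStationary (rate q) μ) {t : ℝ} (ht : 0 ≤ t) :
    worstDist (rate q) μ t ≤ √(Fintype.card S) * Real.exp (-t) :=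
  ciSup_le fun η => hμ.tvDist_law_le ht (tvDist_law_law_le hq ht) η

/-- Two stationary laws are mixtures of the laws at time `t`, so they are within `√|S| e^{-t}` of
each other for every `t ≥ 0`. -/
theorem isStationary_unique {q : S → S → ℝ} (hq : ∀ x y, x ≠ y → 0 ≤ q x y)
    {μ ν : (S → Bool) → ℝ} (hμ : IsStationary (rate q) μ) (hν : IsStationary (rate q) ν) :
    ν = μ := by
  have hlim : Tendsto (fun t => √(Fintype.card S) * Real.exp (-t)) atTop (𝓝 0) := by
    simpa using Real.tendsto_exp_neg_atTop_nhds_zero.const_mul √(Fintype.card S)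
  refine eq_of_tvDist_le_zero (ge_of_tendsto hlim ?_)
  filter_upwards [eventually_ge_atTop 0] with t ht
  exact hμ.tvDist_le hν ht (tvDist_law_law_le hq ht)

end Model

/-! #### The lower bound -/

/-- A differential inequality for `t ↦ Pₜ f x`. -/
theorem sum_transition_mul_le {Ω : Type*} [Fintype Ω] [DecidableEq Ω] {r : Ω → Ω → ℝ}
    (hr : ∀ x y, x ≠ y → 0 ≤ r x y) {f : Ω → ℝ} {c B : ℝ}
    (hf : ∀ x, ∑ y, generator r x y * f y ≤ -c * f x + c * B) {t : ℝ} (ht : 0 ≤ t) (x : Ω) :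
    ∑ y, transition r t x y * f y ≤ B + Real.exp (-(c * t)) * (f x - B) := by
  let u : ℝ → ℝ := fun t => ∑ y, transition r t x y * f y
  have hu : ∀ t, HasDerivAt u (∑ y, transition r t x y * ∑ z, generator r y z * f z) t :=
    hasDerivAt_sum_transition_mul r f x
  have hexp : ∀ t, HasDerivAt (fun t => Real.exp (c * t)) (Real.exp (c * t) * c) t := fun t => by
    simpa using ((hasDerivAt_id t).const_mul c).exp
  have hg : ∀ t, HasDerivAt (fun t => Real.exp (c * t) * (u t - B))
      (Real.exp (c * t) * c * (u t - B) + Real.exp (c * t) *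
        ∑ y, transition r t x y * ∑ z, generator r y z * f z) t :=
    fun t => (hexp t).mul ((hu t).sub_const B)
  have hle : ∀ t, 0 ≤ t →
      ∑ y, transition r t x y * ∑ z, generator r y z * f z ≤ -c * (u t - B) := by
    intro t ht
    calc ∑ y, transition r t x y * ∑ z, generator r y z * f z
        ≤ ∑ y, transition r t x y * (-c * f y + c * B) := by
          gcongr with y
          · exact transition_nonneg hr ht x y
          · exact hf y
      _ = -c * u t + (∑ y, transition r t x y) * (c * B) := by
          rw [Finset.sum_mul, Finset.mul_sum, ← Finset.sum_add_distrib]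
          exact Finset.sum_congr rfl fun y _ => by ring
      _ = -c * (u t - B) := by rw [sum_transition]; ring
  -- Grönwall's argument with the integrating factor `e^{ct}`.
  have hanti : AntitoneOn (fun t => Real.exp (c * t) * (u t - B)) (Set.Ici 0) := by
    refine antitoneOn_of_deriv_nonpos (convex_Ici 0)
      (fun t _ => (hg t).continuousAt.continuousWithinAt)
      (fun t _ => (hg t).differentiableAt.differentiableWithinAt) fun t ht => ?_
    rw [interior_Ici] at ht
    rw [(hg t).deriv]
    have := mul_le_mul_of_nonneg_left (hle t (le_of_lt ht)) (Real.exp_pos (c * t)).le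
    linarith
  have h0 := hanti Set.self_mem_Ici (show t ∈ Set.Ici 0 from ht) ht
  have hu0 : u 0 = f x := by simp [u, transition_zero, Matrix.one_apply]
  simp only [hu0, mul_zero, Real.exp_zero, one_mul] at h0
  have h1 : u t - B = Real.exp (-(c * t)) * (Real.exp (c * t) * (u t - B)) := by
    rw [← mul_assoc, ← Real.exp_add]; simp
  have h2 := mul_le_mul_of_nonneg_left h0 (Real.exp_pos (-(c * t))).le
  change u t ≤ _
  linarith

section Model

variable {S : Type*} [Fintype S] [DecidableEq S]

/-- The value `±1` which stands for a bit. -/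
def spin (b : Bool) : ℝ := if b then 1 else -1

theorem spin_not (b : Bool) : spin (!b) = -spin b := by
  cases b <;> simp [spin]

theorem spin_sq (b : Bool) : spin b ^ 2 = 1 := by
  cases b <;> simp [spin]

/-- The magnetization of a configuration with respect to the weights `π`. -/
def magnetization (π : S → ℝ) (η : S → Bool) : ℝ := ∑ x, π x * spin (η x)

theorem magnetization_flipAt (π : S → ℝ) (η : S → Bool) (x : S) :
    magnetization π (flipAt η x) = magnetization π η - 2 * π x * spin (η x) := by
  simp only [magnetization]
  rw [← Finset.add_sum_erase _ _ (Finset.mem_univ x),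
    ← Finset.add_sum_erase _ (fun x => π x * spin (η x)) (Finset.mem_univ x), flipAt_apply_self,
    spin_not, Finset.sum_congr rfl fun y hy => by
      rw [flipAt, Function.update_of_ne (Finset.ne_of_mem_erase hy)]]
  ring

theorem sum_generator_mul (q : S → S → ℝ) (f : S → ℝ) (x : S) :
    ∑ y, generator q x y * f y = ∑ y ∈ Finset.univ.erase x, q x y * (f y - f x) := by
  rw [← Finset.add_sum_erase _ _ (Finset.mem_univ x)]
  simp only [mul_sub, Finset.sum_sub_distrib, ← Finset.sum_mul]
  rw [Finset.sum_congr rfl fun y hy => by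
    rw [show generator q x y = q x y by simp [generator, (Finset.ne_of_mem_erase hy).symm]]]
  simp only [generator, Matrix.of_apply, if_true, exitRate]
  ring

/-- The voter interaction is linear in the spins: a disagreeing neighbour contributes `spin (η x) -
spin (η y) = 2 * spin (η x)`, an agreeing one 0. -/
theorem flipRate_mul_spin (q : S → S → ℝ) (η : S → Bool) (x : S) :
    flipRate q η x * (2 * spin (η x))
      = spin (η x) - ∑ y, generator q x y * spin (η y) := by
  rw [sum_generator_mul, flipRate, add_mul, Finset.sum_mul, sub_eq_add_neg,
    ← Finset.sum_neg_distrib]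
  congr 1
  · ring
  · refine Finset.sum_congr rfl fun y _ => ?_
    cases η y <;> cases η x <;> norm_num [spin]

/-- The magnetization weighted by a stationary distribution of the voting mechanism is an
eigenfunction of the noisy voter model. -/
theorem sum_generator_rate_mul_magnetization {q : S → S → ℝ} {π : S → ℝ}
    (hπ : IsStationary q π) (η : S → Bool) :
    ∑ ξ, generator (rate q) η ξ * magnetization π ξ = -magnetization π η := by
  rw [sum_generator_rate_mul]
  have h : ∀ x, flipRate q η x * (magnetization π (flipAt η x) - magnetization π η)
      = π x * (∑ y, generator q x y * spin (η y)) - π x * spin (η x) := by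
    intro x
    rw [magnetization_flipAt]
    linear_combination (-π x) * flipRate_mul_spin q η x
  rw [Finset.sum_congr rfl fun x _ => h x, Finset.sum_sub_distrib, hπ.sum_mul_sum_generator,
    zero_sub, magnetization]

/-- A flip at `x` changes the square of `m` by `2 m Δm + (Δm)²`. The first term is governed by the
eigenvalue relation, and `(Δm)² = 4 (π x)²` because spins square to 1. -/
theorem sum_generator_rate_mul_magnetization_sq {q : S → S → ℝ} {π : S → ℝ}
    (hπ : IsStationary q π) (η : S → Bool) :
    ∑ ξ, generator (rate q) η ξ * magnetization π ξ ^ 2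
      = -2 * magnetization π η ^ 2 + 4 * ∑ x, flipRate q η x * π x ^ 2 := by
  have h1 := sum_generator_rate_mul_magnetization hπ η
  rw [sum_generator_rate_mul] at h1 ⊢
  have h : ∀ x, flipRate q η x * (magnetization π (flipAt η x) ^ 2 - magnetization π η ^ 2)
      = 2 * magnetization π η *
          (flipRate q η x * (magnetization π (flipAt η x) - magnetization π η))
        + 4 * (flipRate q η x * π x ^ 2) := by
    intro x
    rw [magnetization_flipAt]
    linear_combination 4 * flipRate q η x * π x ^ 2 * spin_sq (η x)
  simp only [h, Finset.sum_add_distrib, ← Finset.mul_sum, h1]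
  ring

theorem sum_flipRate_mul_sq_le {q : S → S → ℝ} (hq : ∀ x y, x ≠ y → 0 ≤ q x y) {π : S → ℝ}
    (hπ : IsStationary q π) (hpos : ∀ x, 0 < π x) {C R : ℝ} (hC : ∀ x y, π x / π y ≤ C)
    (hR : maxExitRate q ≤ R) (η : S → Bool) :
    ∑ x, flipRate q η x * π x ^ 2 ≤ (1 / 2 + R) * C ^ 2 / Fintype.card S := by
  have hne : Nonempty S := by
    by_contra h
    rw [not_nonempty_iff] at h
    simpa using hπ.sum_eq_one
  have hn : (0 : ℝ) < Fintype.card S := by exact_mod_cast Fintype.card_pos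
  -- The ratio bound, summed over the denominators, bounds the largest mass.
  have hle : ∀ x, π x ≤ C / Fintype.card S := by
    intro x
    rw [le_div_iff₀ hn]
    calc π x * Fintype.card S = ∑ _y : S, π x := by simp [mul_comm]
      _ ≤ ∑ y, C * π y := Finset.sum_le_sum fun y _ => (div_le_iff₀ (hpos y)).1 (hC x y)
      _ = C := by rw [← Finset.mul_sum, hπ.sum_eq_one, mul_one]
  calc ∑ x, flipRate q η x * π x ^ 2
      ≤ ∑ _x : S, (1 / 2 + R) * (C / Fintype.card S) ^ 2 := by
        refine Finset.sum_le_sum fun x _ => ?_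
        have h1 : flipRate q η x ≤ 1 / 2 + R :=
          (flipRate_le hq η x).trans (by linarith [exitRate_le_maxExitRate q x])
        exact mul_le_mul h1 (pow_le_pow_left₀ (hpos x).le (hle x) 2) (sq_nonneg _)
          ((flipRate_nonneg hq η x).trans h1)
    _ = (1 / 2 + R) * C ^ 2 / Fintype.card S := by
        rw [Finset.sum_const, Finset.card_univ, nsmul_eq_mul]
        field_simp

/-- The lower bound on the distance to stationarity from the state of all ones. -/
theorem one_sub_le_tvDist_law {q : S → S → ℝ} (hq : ∀ x y, x ≠ y → 0 ≤ q x y) {π : S → ℝ}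
    (hπ : IsStationary q π) (hpos : ∀ x, 0 < π x) {C R : ℝ} (hC : ∀ x y, π x / π y ≤ C)
    (hR : maxExitRate q ≤ R) {μ : (S → Bool) → ℝ} (hμ : IsStationary (rate q) μ) {t : ℝ}
    (ht : 0 ≤ t) :
    1 - 16 * ((1 / 2 + R) * C ^ 2) * (Real.exp t ^ 2 / Fintype.card S)
      ≤ tvDist (law (rate q) (allOnes S) t) μ := by
  have hr : ∀ η ξ : S → Bool, η ≠ ξ → 0 ≤ rate q η ξ := fun η ξ _ => rate_nonneg hq η ξ
  set V : ℝ := (1 / 2 + R) * C ^ 2 / Fintype.card S with hV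
  have hsq : ∀ η, ∑ ξ, generator (rate q) η ξ * magnetization π ξ ^ 2
      ≤ -2 * magnetization π η ^ 2 + 2 * (2 * V) := by
    intro η
    rw [sum_generator_rate_mul_magnetization_sq hπ]
    linarith [sum_flipRate_mul_sq_le hq hπ hpos hC hR η]
  have hV0 : 0 ≤ V :=
    (Finset.sum_nonneg fun x _ => mul_nonneg (flipRate_nonneg hq (allOnes S) x) (sq_nonneg _)).trans
      (sum_flipRate_mul_sq_le hq hπ hpos hC hR (allOnes S))
  have hstart : magnetization π (allOnes S) = 1 := by
    simp [magnetization, allOnes, spin, hπ.sum_eq_one]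
  -- The differential inequality for the magnetization and for its negative gives equality.
  have hmean : ∑ ξ, law (rate q) (allOnes S) t ξ * magnetization π ξ = Real.exp (-t) := by
    have upper := sum_transition_mul_le hr (f := magnetization π) (c := 1) (B := 0)
      (fun η => by rw [sum_generator_rate_mul_magnetization hπ]; simp) ht (allOnes S)
    have lower := sum_transition_mul_le hr (f := fun η => -magnetization π η) (c := 1) (B := 0)
      (fun η => by
        simp only [mul_neg, Finset.sum_neg_distrib]
        rw [sum_generator_rate_mul_magnetization hπ]; simp) ht (allOnes S)
    simp only [mul_neg, Finset.sum_neg_distrib, hstart, one_mul, sub_zero, zero_add,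
      mul_one] at upper lower
    exact le_antisymm upper (by simpa [law] using lower)
  have hvar : ∑ ξ, law (rate q) (allOnes S) t ξ * magnetization π ξ ^ 2
      ≤ Real.exp (-t) ^ 2 + 2 * V := by
    have h := sum_transition_mul_le hr (f := fun η => magnetization π η ^ 2) hsq ht
      (allOnes S)
    have he : Real.exp (-(2 * t)) = Real.exp (-t) ^ 2 := by
      rw [← Real.exp_nat_mul]; congr 1; push_cast; ring
    simp only [hstart, he] at h
    have : 0 ≤ Real.exp (-t) ^ 2 * (2 * V) := by positivity
    refine h.trans ?_
    linarith
  -- In equilibrium the generator has mean zero, so the drift inequality directly bounds the second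
  -- moment.
  have hvar' : ∑ ξ, μ ξ * magnetization π ξ ^ 2 ≤ 2 * V := by
    have h0 := hμ.sum_mul_sum_generator fun ξ => magnetization π ξ ^ 2
    have h1 := Finset.sum_le_sum fun η (_ : η ∈ Finset.univ) =>
      mul_le_mul_of_nonneg_left (hsq η) (hμ.nonneg η)
    rw [h0] at h1
    simp only [mul_add, Finset.sum_add_distrib, ← Finset.sum_mul, hμ.sum_eq_one,
      mul_left_comm (μ _) (-2 : ℝ), ← Finset.mul_sum] at h1
    linarith
  have key := one_sub_le_tvDist (transition_nonneg hr ht (allOnes S)) hμ.nonneg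
    (sum_transition (rate q) t (allOnes S)) hμ.sum_eq_one (Real.exp_pos (-t)) hmean hvar hvar'
  refine le_trans (le_of_eq ?_) key
  rw [hV, Real.exp_neg]
  field_simp
  ring

end Model

end NoisyVoter

/-! ### Mixing times and cutoff -/

/-- Real-valued `liminf` is meaningful only for bounded sequences, hence the bounds on both sides.
-/
theorem Filter.tendsto_liminf_of_bounds {u : ℝ → ℕ → ℝ} {a b : ℝ → ℝ} {l : ℝ}
    (ha : Tendsto a atTop (𝓝 l)) (hb : Tendsto b atTop (𝓝 l))
    (h : ∀ᶠ α in atTop, ∀ᶠ n in atTop, a α ≤ u α n ∧ u α n ≤ b α) :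
    Tendsto (fun α => liminf (u α) atTop) atTop (𝓝 l) := by
  refine tendsto_of_tendsto_of_tendsto_of_le_of_le' ha hb ?_ ?_ <;> filter_upwards [h] with α hα
  · exact le_liminf_of_le (IsBoundedUnder.isCoboundedUnder_ge
      ⟨b α, eventually_map.2 (hα.mono fun _ => And.right)⟩)
      (hα.mono fun _ => And.left)
  · exact liminf_le_of_le ⟨a α, eventually_map.2 (hα.mono fun _ => And.left)⟩ fun c hc =>
      (hc.and hα).exists.elim fun n hn => hn.1.trans hn.2.2

theorem Filter.tendsto_limsup_of_bounds {u : ℝ → ℕ → ℝ} {a b : ℝ → ℝ} {l : ℝ}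
    (ha : Tendsto a atTop (𝓝 l)) (hb : Tendsto b atTop (𝓝 l))
    (h : ∀ᶠ α in atTop, ∀ᶠ n in atTop, a α ≤ u α n ∧ u α n ≤ b α) :
    Tendsto (fun α => limsup (u α) atTop) atTop (𝓝 l) := by
  refine tendsto_of_tendsto_of_tendsto_of_le_of_le' ha hb ?_ ?_ <;> filter_upwards [h] with α hα
  · exact le_limsup_of_le ⟨b α, eventually_map.2 (hα.mono fun _ => And.right)⟩ fun c hc =>
      (hc.and hα).exists.elim fun n hn => hn.2.1.trans hn.1
  · exact limsup_le_of_le (IsBoundedUnder.isCoboundedUnder_le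
      ⟨a α, eventually_map.2 (hα.mono fun _ => And.left)⟩)
      (hα.mono fun _ => And.right)

namespace NoisyVoter

theorem mixingTime_le {d : ℝ → ℝ} {ε t : ℝ} (ht : 0 ≤ t) (h : d t ≤ ε) : mixingTime d ε ≤ t :=
  csInf_le ⟨0, fun _ hs => hs.1⟩ ⟨ht, h⟩

/-! ### Mixing times from exponential bounds on both sides of `L` -/

section Profile

variable {d : ℕ → ℝ → ℝ} {L : ℕ → ℝ} {K : ℝ}

theorem eventually_mixingTime_le
    (hL : Tendsto L atTop atTop)
    (hup : ∀ᶠ n in atTop, ∀ t, 0 ≤ t → d n t ≤ Real.exp (L n - t))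
    {ε : ℝ} (hε : 0 < ε) :
    ∃ a, ∀ᶠ n in atTop, mixingTime (d n) ε ≤ L n + a := by
  -- The time at which `e^{L - t}` equals `ε`.
  refine ⟨-Real.log ε, ?_⟩
  filter_upwards [hup, hL.eventually_ge_atTop (Real.log ε)] with n hn hLn
  have ht : 0 ≤ L n + -Real.log ε := by linarith
  refine mixingTime_le ht ((hn _ ht).trans (le_of_eq ?_))
  rw [show L n - (L n + -Real.log ε) = Real.log ε by ring, Real.exp_log hε]

theorem eventually_abs_mixingTime_sub_le
    (hL : Tendsto L atTop atTop)
    (hup : ∀ᶠ n in atTop, ∀ t, 0 ≤ t → d n t ≤ Real.exp (L n - t))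
    (hlow : ∀ᶠ n in atTop, ∀ t, 0 ≤ t →
      1 - K * Real.exp (2 * (t - L n)) ≤ d n t ∧ d n t ≤ 1)
    {ε : ℝ} (h0 : 0 < ε) (h1 : ε < 1) :
    ∃ a, ∀ᶠ n in atTop, |mixingTime (d n) ε - L n| ≤ a := by
  obtain ⟨a, ha⟩ := eventually_mixingTime_le hL hup h0
  have hK : Tendsto (fun b : ℝ => |K| * Real.exp (-(2 * b))) atTop (𝓝 0) := by
    simpa using (Real.tendsto_exp_neg_atTop_nhds_zero.comp
      (tendsto_id.const_mul_atTop (two_pos (α := ℝ)))).const_mul |K|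
  -- `b` is such that the distance still exceeds `ε` at every nonnegative time before `L - b`. The
  -- sign of `K` is unknown, hence `|K|`.
  obtain ⟨b, hb⟩ := (hK.eventually (gt_mem_nhds (sub_pos.2 h1))).exists
  refine ⟨max a b, ?_⟩
  filter_upwards [ha, hup, hlow, hL.eventually_ge_atTop (Real.log ε)] with n han hn hln hLn
  rw [abs_le]
  refine ⟨?_, by linarith [le_max_left a b]⟩
  have hle : L n - b ≤ mixingTime (d n) ε := by
    have ht : 0 ≤ L n - Real.log ε := by linarith
    refine le_csInf ⟨L n - Real.log ε, ht, (hn _ ht).trans (le_of_eq ?_)⟩ fun t ht => ?_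
    · rw [sub_sub_cancel, Real.exp_log h0]
    · by_contra! hlt
      have e1 := (hln t ht.1).1.trans ht.2
      have e2 : K * Real.exp (2 * (t - L n)) ≤ |K| * Real.exp (-(2 * b)) := by
        gcongr
        · exact le_abs_self K
        · linarith
      linarith
  linarith [le_max_right a b]

theorem tendsto_mixingTime_div
    (hL : Tendsto L atTop atTop)
    (hup : ∀ᶠ n in atTop, ∀ t, 0 ≤ t → d n t ≤ Real.exp (L n - t))
    (hlow : ∀ᶠ n in atTop, ∀ t, 0 ≤ t →
      1 - K * Real.exp (2 * (t - L n)) ≤ d n t ∧ d n t ≤ 1)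
    {ε : ℝ} (h0 : 0 < ε) (h1 : ε < 1) :
    Tendsto (fun n => mixingTime (d n) ε / L n) atTop (𝓝 1) := by
  obtain ⟨a, ha⟩ := eventually_abs_mixingTime_sub_le hL hup hlow h0 h1
  have hz : Tendsto (fun n => (mixingTime (d n) ε - L n) / L n) atTop (𝓝 0) := by
    refine squeeze_zero_norm' ?_ (hL.const_div_atTop a)
    filter_upwards [ha, hL.eventually_gt_atTop 0] with n hn hLn
    rw [Real.norm_eq_abs, abs_div, abs_of_pos hLn]
    gcongr
  have := hz.const_add 1
  rw [add_zero] at this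
  refine this.congr' ?_
  filter_upwards [hL.eventually_gt_atTop 0] with n hLn
  field_simp
  ring

theorem hasCutoff_of_profile
    (hL : Tendsto L atTop atTop)
    (hup : ∀ᶠ n in atTop, ∀ t, 0 ≤ t → d n t ≤ Real.exp (L n - t))
    (hlow : ∀ᶠ n in atTop, ∀ t, 0 ≤ t →
      1 - K * Real.exp (2 * (t - L n)) ≤ d n t ∧ d n t ≤ 1) : HasCutoff d := by
  intro ε h0 h1
  have h := (tendsto_mixingTime_div hL hup hlow h0 h1).div
    (tendsto_mixingTime_div hL hup hlow (sub_pos.2 h1) (sub_lt_self 1 h0)) one_ne_zero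
  rw [div_one] at h
  refine h.congr' ?_
  filter_upwards [hL.eventually_gt_atTop 0] with n hLn
  exact div_div_div_cancel_right₀ hLn.ne' _ _

/-- The mixing time is within a constant `a` of `L`, so recentring the bounds there only shifts `α`
by `a`. -/
theorem hasCutoffWithWindow_of_profile
    (hL : Tendsto L atTop atTop)
    (hup : ∀ᶠ n in atTop, ∀ t, 0 ≤ t → d n t ≤ Real.exp (L n - t))
    (hlow : ∀ᶠ n in atTop, ∀ t, 0 ≤ t →
      1 - K * Real.exp (2 * (t - L n)) ≤ d n t ∧ d n t ≤ 1)
    (hd : ∀ n t, 0 ≤ d n t) :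
    HasCutoffWithWindow d fun _ => 1 := by
  obtain ⟨a, ha⟩ := eventually_abs_mixingTime_sub_le hL hup hlow (ε := 1 / 4) (by norm_num)
    (by norm_num)
  have hm : Tendsto (fun n => mixingTime (d n) (1 / 4)) atTop atTop := by
    refine tendsto_atTop_mono' _ ?_ (tendsto_atTop_add_const_right _ (-a) hL)
    filter_upwards [ha] with n hn
    linarith [(abs_le.1 hn).1]
  refine ⟨Asymptotics.isLittleO_const_left.2 (.inr (tendsto_norm_atTop_atTop.comp hm)), ?_, ?_⟩
  · have hK : Tendsto (fun α : ℝ => 1 - |K| * Real.exp (-(2 * (α - a)))) atTop (𝓝 1) := by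
      simpa [sub_eq_add_neg] using ((Real.tendsto_exp_neg_atTop_nhds_zero.comp ((tendsto_atTop_add_const_right _
        (-a) tendsto_id).const_mul_atTop (two_pos (α := ℝ)))).const_mul |K|).const_sub 1
    refine tendsto_liminf_of_bounds hK (tendsto_const_nhds (x := (1 : ℝ)))
      (Eventually.of_forall fun α => ?_)
    filter_upwards [ha, hlow, hm.eventually_ge_atTop α] with n hn hln hmn
    have h := hln (mixingTime (d n) (1 / 4) - α * 1) (by linarith)
    refine ⟨le_trans ?_ h.1, h.2⟩
    gcongr
    · exact le_abs_self K
    · linarith [(abs_le.1 hn).2]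
  · have hE : Tendsto (fun α : ℝ => Real.exp (-(α - a))) atTop (𝓝 0) :=
      Real.tendsto_exp_neg_atTop_nhds_zero.comp
        (tendsto_atTop_add_const_right _ (-a) tendsto_id)
    refine tendsto_limsup_of_bounds (tendsto_const_nhds (x := (0 : ℝ))) hE
      (Eventually.of_forall fun α => ?_)
    filter_upwards [ha, hup, hm.eventually_ge_atTop (-α)] with n hn hun hmn
    refine ⟨hd n _, (hun _ (by linarith)).trans ?_⟩
    gcongr
    linarith [(abs_le.1 hn).1]

end Profile

end NoisyVoter

theorem theorem1 {S : ℕ → Type*} [∀ n, Fintype (S n)] [∀ n, DecidableEq (S n)]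
    (q : ∀ n, S n → S n → ℝ)
    (hq : ∀ n x y, x ≠ y → 0 ≤ q n x y)
    (hS : Tendsto (fun n => Fintype.card (S n)) atTop atTop) :
    ∃ μ : ∀ n, (S n → Bool) → ℝ,
      -- `μ n` is the unique stationary distribution of the `n`-th noisy voter model
      (∀ n, NoisyVoter.IsStationary (NoisyVoter.rate (q n)) (μ n) ∧
        ∀ ν, NoisyVoter.IsStationary (NoisyVoter.rate (q n)) ν → ν = μ n) ∧
      -- the upper bounds, which need only `|S n| → ∞`
      Tendsto
        (fun α : ℝ => limsup (fun n =>
          NoisyVoter.worstDist (NoisyVoter.rate (q n)) (μ n)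
            ((1 / 2) * Real.log (Fintype.card (S n)) + α)) atTop)
        atTop (𝓝 0) ∧
      (∀ ε : ℝ, 0 < ε → ∀ δ : ℝ, 0 < δ → ∀ᶠ n in atTop,
        NoisyVoter.mixingTime (NoisyVoter.worstDist (NoisyVoter.rate (q n)) (μ n)) ε
          ≤ (1 / 2) * Real.log (Fintype.card (S n)) * (1 + δ)) ∧
      -- the full result, for bounded rates and almost uniform stationary distributions
      (BddAbove (Set.range fun n => NoisyVoter.maxExitRate (q n)) →
        (∃ C : ℝ, ∀ n, ∃ π : S n → ℝ, NoisyVoter.IsStationary (q n) π ∧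
          (∀ x, 0 < π x) ∧ ∀ x y, π x / π y ≤ C) →
        (∀ ε : ℝ, 0 < ε → ε < 1 →
          Tendsto
            (fun n =>
              NoisyVoter.mixingTime (NoisyVoter.worstDist (NoisyVoter.rate (q n)) (μ n)) ε
                / ((1 / 2) * Real.log (Fintype.card (S n))))
            atTop (𝓝 1)) ∧
        Tendsto
          (fun α : ℝ => liminf (fun n =>
            NoisyVoter.tvDist
              (NoisyVoter.law (NoisyVoter.rate (q n)) (NoisyVoter.allOnes (S n))
                ((1 / 2) * Real.log (Fintype.card (S n)) - α))
              (μ n)) atTop)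
          atTop (𝓝 1) ∧
        NoisyVoter.HasCutoff
          (fun n => NoisyVoter.worstDist (NoisyVoter.rate (q n)) (μ n)) ∧
        NoisyVoter.HasCutoffWithWindow
          (fun n => NoisyVoter.worstDist (NoisyVoter.rate (q n)) (μ n)) (fun _ => 1)) := by
  have hr : ∀ n (η ξ : S n → Bool), η ≠ ξ → 0 ≤ NoisyVoter.rate (q n) η ξ :=
    fun n η ξ _ => NoisyVoter.rate_nonneg (hq n) η ξ
  choose μ hμ using fun n => NoisyVoter.exists_isStationary (hr n)
  set L : ℕ → ℝ := fun n => 1 / 2 * Real.log (Fintype.card (S n)) with hLdef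
  have hL : Tendsto L atTop atTop :=
    (Real.tendsto_log_atTop.comp (tendsto_natCast_atTop_atTop.comp hS)).const_mul_atTop
      (by norm_num)
  -- This turns `√|S| e^{-t}` into `e^{L - t}` and `e^{2t} / |S|` into `e^{2(t - L)}`; it holds once
  -- `S n` is nonempty.
  have hexp : ∀ᶠ n in atTop, Real.exp (L n) ^ 2 = Fintype.card (S n) := by
    filter_upwards [hS.eventually_gt_atTop 0] with n hn
    rw [← Real.exp_nat_mul, hLdef]
    push_cast
    rw [← mul_assoc, show (2 : ℝ) * (1 / 2) = 1 by norm_num, one_mul,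
      Real.exp_log (by exact_mod_cast hn)]
  have hup : ∀ᶠ n in atTop, ∀ t, 0 ≤ t →
      NoisyVoter.worstDist (NoisyVoter.rate (q n)) (μ n) t ≤ Real.exp (L n - t) := by
    filter_upwards [hexp] with n hn t ht
    refine (NoisyVoter.worstDist_le (hq n) (hμ n) ht).trans (le_of_eq ?_)
    rw [← hn, Real.sqrt_sq (Real.exp_pos _).le, ← Real.exp_add, ← sub_eq_add_neg]
  refine ⟨μ, fun n => ⟨hμ n, fun ν hν => NoisyVoter.isStationary_unique (hq n) (hμ n) hν⟩,
    ?_, ?_, ?_⟩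
  · refine tendsto_limsup_of_bounds (tendsto_const_nhds (x := (0 : ℝ)))
      Real.tendsto_exp_neg_atTop_nhds_zero (Eventually.of_forall fun α => ?_)
    filter_upwards [hup, hL.eventually_ge_atTop (-α)] with n hn hLn
    refine ⟨NoisyVoter.worstDist_nonneg _ _ _, (hn (L n + α) (by linarith)).trans (le_of_eq ?_)⟩
    rw [sub_add_cancel_left]
  · intro ε hε δ hδ
    obtain ⟨a, ha⟩ := NoisyVoter.eventually_mixingTime_le hL hup hε
    filter_upwards [ha, (hL.const_mul_atTop hδ).eventually_ge_atTop a] with n hn hLn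
    refine hn.trans ?_
    change L n + a ≤ L n * (1 + δ)
    linarith
  · rintro ⟨R, hR⟩ ⟨C, hC⟩
    have hlaw : ∀ᶠ n in atTop, ∀ t, 0 ≤ t →
        1 - 16 * ((1 / 2 + R) * C ^ 2) * Real.exp (2 * (t - L n)) ≤ NoisyVoter.tvDist
          (NoisyVoter.law (NoisyVoter.rate (q n)) (NoisyVoter.allOnes (S n)) t) (μ n) := by
      filter_upwards [hexp] with n hn t ht
      obtain ⟨π, hπ, hpos, hratio⟩ := hC n
      refine le_trans (le_of_eq ?_) (NoisyVoter.one_sub_le_tvDist_law (hq n) hπ hpos hratio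
        (hR ⟨n, rfl⟩) (hμ n) ht)
      rw [← hn, ← div_pow, ← Real.exp_sub, ← Real.exp_nat_mul]
      norm_num
    have hlow : ∀ᶠ n in atTop, ∀ t, 0 ≤ t →
        1 - 16 * ((1 / 2 + R) * C ^ 2) * Real.exp (2 * (t - L n))
            ≤ NoisyVoter.worstDist (NoisyVoter.rate (q n)) (μ n) t ∧
          NoisyVoter.worstDist (NoisyVoter.rate (q n)) (μ n) t ≤ 1 := by
      filter_upwards [hlaw] with n hn t ht
      exact ⟨(hn t ht).trans (NoisyVoter.tvDist_le_worstDist _ _ _ _),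
        (hμ n).worstDist_le_one (hr n) ht⟩
    refine ⟨fun ε h0 h1 => NoisyVoter.tendsto_mixingTime_div hL hup hlow h0 h1, ?_,
      NoisyVoter.hasCutoff_of_profile hL hup hlow,
      NoisyVoter.hasCutoffWithWindow_of_profile hL hup hlow
        fun n t => NoisyVoter.worstDist_nonneg _ _ _⟩
    have hK : Tendsto (fun α : ℝ => 1 - 16 * ((1 / 2 + R) * C ^ 2) * Real.exp (-(2 * α))) atTop
        (𝓝 1) := by
      simpa using ((Real.tendsto_exp_neg_atTop_nhds_zero.comp
        (tendsto_id.const_mul_atTop (two_pos (α := ℝ)))).const_mul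
          (16 * ((1 / 2 + R) * C ^ 2))).const_sub 1
    refine tendsto_liminf_of_bounds hK (tendsto_const_nhds (x := (1 : ℝ)))
      (Eventually.of_forall fun α => ?_)
    filter_upwards [hlaw, hL.eventually_ge_atTop α] with n hn hLn
    have ht : 0 ≤ L n - α := by linarith
    refine ⟨le_trans (le_of_eq ?_) (hn (L n - α) ht), ?_⟩
    · rw [sub_sub_cancel_left, mul_neg]
    · exact NoisyVoter.tvDist_le_one (NoisyVoter.transition_nonneg (hr n) ht _) (hμ n).nonneg
        (NoisyVoter.sum_transition _ _ _) (hμ n).sum_eq_one
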